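/- Let $(k,|\cdot|)$ be a field that is complete with respect to a non-Archimedean (possibly trivial) absolute value. **The tropical hyperfield.** A hyperring is a set with a commutative multiplicative monoid structure and a canonical hypergroup structure (a multivalued addition $\boxplus$ that is commutative, associative, reversible, with identity $0$ and unique inverses), such that multiplication distributes over $\boxplus$ and $0$ is absorbing; it is a hyperfield if $1\neq 0$ and all nonzero elements are invertible. A homomorphism $f$ of hyperrings is a homomorphism of multiplicative monoids with $f(0)=0$ and $f(a\boxplus b)\subseteq f(a)\boxplus f(b)$. Commutative rings are hyperrings. Let $\mathbb T=\mathbb R\cup\{-\infty\}$ be the tropical hyperfield: multiplication is addition of reals (with $-\infty$ absorbing), $x\boxplus y=\{\max(x,y)\}$ if $x\ne y$, and $x\boxplus x=[-\infty,x]$. Give $\mathbb T\cong[0,\infty)$ the Euclidean (order) topology. Put $\nu=\log|\cdot|:k\to\mathbb T$, $\nu(0)=-\infty$; it is a homomorphism of hyperrings. **$\mathbb T$-points.** A locally hyperringed space is a topological space with a sheaf of hyperrings whose stalks exist and have a unique maximal ideal; morphisms are required to be local on stalks. Schemes, and the one-point space $\operatorname{Spec}\mathbb T$ with structure sheaf $\mathbb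 T$, are locally hyperringed spaces. For a $k$-scheme $X$ let $X(\mathbb T)$ be the set of morphisms $\operatorname{Spec}\mathbb T\to X$ of locally hyperringed spaces whose composite with $X\to\operatorname{Spec}k$ is the morphism $\operatorname{Spec}\mathbb T\to\operatorname{Spec}k$ given by $\nu$. For $Y$ affine, the affine topology on $Y(\mathbb T)$ is the coarsest one for which all evaluations $Y(\mathbb T)\to\mathbb T$ at elements of $\Gamma(Y,\mathcal O_Y)$ are continuous. The fine Zariski topology on $X(\mathbb T)$ is the finest topology for which, for all affine $k$-schemes $Y$ and all $k$-morphisms $Y\to X$, the map $Y(\mathbb T)\to X(\mathbb T)$ is continuous for the affine topology on $Y(\mathbb T)$. **Analytification.** The underlying space $|X^{\mathrm{an}}|$ of the Berkovich analytification of $X$ is the set of pairs $(x,|\cdot|_x)$ of a point $x\in X$ and an absolute value on the residue field $\kappa(x)$ extending that of $k$, with the coarsest topology such that $X^{\mathrm{an}}\to X$ is continuous and, for all open $U\subseteq X$ and $s\in\mathcal O_X(U)$, the function $(x,|\cdot|_x)\mapsto|s(x)|_x$ is continuous on the preimage of $U$. **Theorem.** For every scheme $X$ of finite type over $k$ there is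 a homeomorphism $h_X:|X^{\mathrm{an}}|\to X(\mathbb T)$, where $X(\mathbb T)$ carries the fine Zariski topology; it sends $(x,|\cdot|_x)$ to a morphism $\operatorname{Spec}\mathbb T\to X$ with image $x$ that pulls back each section $s$ of $\mathcal O_X$ defined near $x$ to $\log|s(x)|_x\in\mathbb T$. The homeomorphisms $h_X$ form an isomorphism between the functors $X\mapsto|X^{\mathrm{an}}|$ and $X\mapsto X(\mathbb T)=\operatorname{Hom}_k(\operatorname{Spec}\mathbb T,X)$ from schemes of finite type over $k$ to topological spaces; that is, $X\mapsto|X^{\mathrm{an}}|$ is representable by $\mathbb T$. -/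

import Mathlib

open CategoryTheory CategoryTheory.Limits TopologicalSpace Opposite AlgebraicGeometry

universe u v

namespace HyperGeom

/-! ### Hyperrings -/

/-- A (commutative) hyperring: `(R, ⊞)` is a canonical hypergroup with identity `0`, and
`(R, *)` is a commutative monoid, distributing over `⊞` and absorbed by `0`. -/
class Hyperring (R : Type u) extends CommMonoidWithZero R, Neg R where
  /-- The hyperaddition. -/
  hadd : R → R → Set R
  hadd_nonempty : ∀ x y, (hadd x y).Nonempty
  hadd_comm : ∀ x y, hadd x y = hadd y x
  hadd_assoc : ∀ x y z, ⋃ w ∈ hadd x y, hadd w z = ⋃ w ∈ hadd y z, hadd x w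
  zero_hadd : ∀ x, hadd 0 x = {x}
  /-- `-x` is the unique inverse of `x`. -/
  zero_mem_hadd_iff : ∀ x y, 0 ∈ hadd x y ↔ y = -x
  /-- Reversibility. -/
  reversible : ∀ x y z, x ∈ hadd y z → y ∈ hadd x (-z)
  mul_hadd : ∀ x y z, (fun t => x * t) '' hadd y z = hadd (x * y) (x * z)

open Hyperring (hadd)

/-- A hyperfield: a nonzero hyperring whose nonzero elements are invertible. -/
class IsHyperfield (H : Type u) [Hyperring H] : Prop extends Nontrivial H where
  exists_mul_eq_one : ∀ x : H, x ≠ 0 → ∃ y, x * y = 1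

/-- A homomorphism of hyperrings; it need not be strict. -/
structure HyperringHom (R : Type u) (S : Type v) [Hyperring R] [Hyperring S] extends R →*₀ S where
  map_hadd' : ∀ a b c, c ∈ hadd a b → toFun c ∈ hadd (toFun a) (toFun b)

namespace HyperringHom

variable {R S T : Type*} [Hyperring R] [Hyperring S] [Hyperring T]

instance : FunLike (HyperringHom R S) R S where
  coe f := f.toFun
  coe_injective f g h := by
    obtain ⟨f, hf⟩ := f
    obtain ⟨g, hg⟩ := g
    congr 1
    exact DFunLike.coe_injective h

instance : MonoidWithZeroHomClass (HyperringHom R S) R S where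
  map_mul f := f.map_mul'
  map_one f := f.map_one'
  map_zero f := f.map_zero'

theorem map_hadd (f : HyperringHom R S) {a b c : R} (h : c ∈ hadd a b) :
    f c ∈ hadd (f a) (f b) :=
  f.map_hadd' a b c h

@[ext]
theorem ext {f g : HyperringHom R S} (h : ∀ x, f x = g x) : f = g :=
  DFunLike.ext _ _ h

/-- The identity homomorphism. -/
def id (R : Type*) [Hyperring R] : HyperringHom R R where
  toMonoidWithZeroHom := MonoidWithZeroHom.id R
  map_hadd' _ _ _ h := h

/-- Composition of homomorphisms. -/
def comp (g : HyperringHom S T) (f : HyperringHom R S) : HyperringHom R T where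
  toMonoidWithZeroHom := g.toMonoidWithZeroHom.comp f.toMonoidWithZeroHom
  map_hadd' _ _ _ h := g.map_hadd (f.map_hadd h)

theorem map_neg (f : HyperringHom R S) (a : R) : f (-a) = -f a := by
  rw [← Hyperring.zero_mem_hadd_iff]
  have h := f.map_hadd ((Hyperring.zero_mem_hadd_iff a (-a)).2 rfl)
  rwa [map_zero] at h

end HyperringHom

/-- The category of hyperrings. -/
structure HyperringCat : Type (u + 1) where
  /-- The underlying type. -/
  carrier : Type u
  [str : Hyperring carrier]

attribute [instance] HyperringCat.str

namespace HyperringCat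

instance : CoeSort HyperringCat.{u} (Type u) := ⟨HyperringCat.carrier⟩

/-- The object of the category attached to a hyperring. -/
abbrev of (R : Type u) [Hyperring R] : HyperringCat.{u} := ⟨R⟩

/-- Morphisms of the category of hyperrings. -/
@[ext]
structure Hom (R S : HyperringCat.{u}) where
  /-- The underlying homomorphism. -/
  hom' : HyperringHom R S

instance : Category HyperringCat.{u} where
  Hom R S := Hom R S
  id R := ⟨HyperringHom.id R⟩
  comp f g := ⟨g.hom'.comp f.hom'⟩

instance : ConcreteCategory HyperringCat.{u} (fun R S => HyperringHom R S) where
  hom := Hom.hom'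
  ofHom := Hom.mk

/-- The homomorphism underlying a morphism. -/
abbrev Hom.hom {R S : HyperringCat.{u}} (f : R ⟶ S) : HyperringHom R S :=
  ConcreteCategory.hom (C := HyperringCat) f

end HyperringCat

/-- A commutative ring is a hyperring with single-valued hyperaddition. -/
@[reducible]
def hyperringOfCommRing (A : Type u) [CommRing A] : Hyperring A where
  hadd a b := {a + b}
  hadd_nonempty _ _ := ⟨_, rfl⟩
  hadd_comm a b := by rw [add_comm]
  hadd_assoc a b c := by simp [add_assoc]
  zero_hadd a := by simp
  zero_mem_hadd_iff a b := by
    rw [Set.mem_singleton_iff, eq_comm, add_comm, add_eq_zero_iff_eq_neg]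
  reversible a b c h := by
    rw [Set.mem_singleton_iff] at h ⊢
    rw [h, add_neg_cancel_right]
  mul_hadd a b c := by simp [mul_add]

/-- A ring homomorphism, as a homomorphism of hyperrings. -/
def hyperringHomOfRingHom {A B : Type u} [CommRing A] [CommRing B] (f : A →+* B) :
    letI := hyperringOfCommRing A
    letI := hyperringOfCommRing B
    HyperringHom A B :=
  letI := hyperringOfCommRing A
  letI := hyperringOfCommRing B
  { toFun := f
    map_zero' := f.map_zero
    map_one' := f.map_one
    map_mul' := f.map_mul
    map_hadd' := by
      rintro a b c rfl
      exact map_add f a b }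

/-- The inclusion of commutative rings into hyperrings. -/
def ringToHyperring : CommRingCat.{u} ⥤ HyperringCat.{u} where
  obj A := letI := hyperringOfCommRing A; HyperringCat.of A
  map f := ⟨hyperringHomOfRingHom f.hom⟩
  map_id _ := rfl
  map_comp _ _ := rfl

/-- A product of hyperrings, with componentwise operations. -/
instance Pi.hyperring {ι : Type u} (R : ι → Type v) [∀ i, Hyperring (R i)] :
    Hyperring (∀ i, R i) where
  hadd f g := {h | ∀ i, h i ∈ hadd (f i) (g i)}
  hadd_nonempty f g := by
    choose h hh using fun i => Hyperring.hadd_nonempty (f i) (g i)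
    exact ⟨h, hh⟩
  hadd_comm f g := by
    ext h
    simp only [Set.mem_ofPred_eq, Hyperring.hadd_comm]
  hadd_assoc f g h := by
    have key : ∀ i t, (∃ w ∈ hadd (f i) (g i), t ∈ hadd w (h i)) ↔
        ∃ w ∈ hadd (g i) (h i), t ∈ hadd (f i) w := by
      intro i t
      have := Set.ext_iff.1 (Hyperring.hadd_assoc (f i) (g i) (h i)) t
      simpa only [Set.mem_iUnion, exists_prop] using this
    ext t
    simp only [Set.mem_iUnion, exists_prop, Set.mem_ofPred_eq]
    constructor
    · rintro ⟨w, hw, ht⟩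
      choose v hv hv' using fun i => (key i (t i)).1 ⟨w i, hw i, ht i⟩
      exact ⟨v, hv, hv'⟩
    · rintro ⟨w, hw, ht⟩
      choose v hv hv' using fun i => (key i (t i)).2 ⟨w i, hw i, ht i⟩
      exact ⟨v, hv, hv'⟩
  zero_hadd f := by
    ext h
    simp [Hyperring.zero_hadd, funext_iff]
  zero_mem_hadd_iff f g := by
    simp [Hyperring.zero_mem_hadd_iff, funext_iff]
  reversible f g h hh i := Hyperring.reversible _ _ _ (hh i)
  mul_hadd f g h := by
    ext t
    simp only [Set.mem_image, Set.mem_ofPred_eq, Pi.mul_apply, ← Hyperring.mul_hadd]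
    constructor
    · rintro ⟨s, hs, rfl⟩ i
      exact ⟨s i, hs i, rfl⟩
    · intro ht
      choose s hs hs' using ht
      exact ⟨s, hs, funext hs'⟩

/-! ### Ideals -/

section Ideals

variable {R : Type u} [Hyperring R]

/-- An ideal: a sub-hypergroup stable under multiplication by `R`. -/
structure IsIdeal (I : Set R) : Prop where
  zero_mem : 0 ∈ I
  hadd_subset : ∀ a ∈ I, ∀ b ∈ I, hadd a b ⊆ I
  neg_mem : ∀ a ∈ I, -a ∈ I
  mul_mem : ∀ r, ∀ a ∈ I, r * a ∈ I

/-- A maximal ideal: a proper ideal contained in no other proper ideal. -/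
structure IsMaximalIdeal (I : Set R) : Prop where
  isIdeal : IsIdeal I
  ne_univ : I ≠ Set.univ
  eq_of_subset : ∀ J : Set R, IsIdeal J → J ≠ Set.univ → I ⊆ J → J = I

/-- A prime ideal: an ideal whose complement is a multiplicative submonoid. -/
structure IsPrimeIdeal (I : Set R) : Prop where
  isIdeal : IsIdeal I
  one_notMem : 1 ∉ I
  mem_or_mem : ∀ a b, a * b ∈ I → a ∈ I ∨ b ∈ I

theorem IsIdeal.preimage {S : Type v} [Hyperring S] (f : HyperringHom R S) {I : Set S}
    (hI : IsIdeal I) : IsIdeal (f ⁻¹' I) where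
  zero_mem := by
    rw [Set.mem_preimage, map_zero]
    exact hI.zero_mem
  hadd_subset a ha b hb _ hc := hI.hadd_subset _ ha _ hb (f.map_hadd hc)
  neg_mem a ha := by
    rw [Set.mem_preimage, f.map_neg]
    exact hI.neg_mem _ ha
  mul_mem r a ha := by
    rw [Set.mem_preimage, map_mul]
    exact hI.mul_mem _ _ ha

theorem IsIdeal.eq_univ_of_one_mem {I : Set R} (hI : IsIdeal I) (h : 1 ∈ I) : I = Set.univ :=
  Set.eq_univ_of_forall fun r => by simpa using hI.mul_mem r 1 h

theorem isIdeal_zero : IsIdeal ({0} : Set R) where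
  zero_mem := rfl
  hadd_subset := by
    rintro _ rfl _ rfl
    rw [Hyperring.zero_hadd]
  neg_mem := by
    rintro _ rfl
    rw [Set.mem_singleton_iff, eq_comm, ← Hyperring.zero_mem_hadd_iff, Hyperring.zero_hadd]
    rfl
  mul_mem := by
    rintro r _ rfl
    simp

theorem IsIdeal.eq_zero_of_isHyperfield [IsHyperfield R] {I : Set R} (hI : IsIdeal I)
    (h : I ≠ Set.univ) : I = {0} := by
  ext a
  refine ⟨fun ha => ?_, ?_⟩
  · by_contra h0
    obtain ⟨b, hb⟩ := IsHyperfield.exists_mul_eq_one a h0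
    refine h (hI.eq_univ_of_one_mem ?_)
    rw [← hb, mul_comm]
    exact hI.mul_mem _ _ ha
  · rintro rfl
    exact hI.zero_mem

theorem isMaximalIdeal_iff_of_isHyperfield [IsHyperfield R] {I : Set R} :
    IsMaximalIdeal I ↔ I = {0} := by
  refine ⟨fun h => h.isIdeal.eq_zero_of_isHyperfield h.ne_univ, ?_⟩
  rintro rfl
  refine ⟨isIdeal_zero, fun h => ?_, fun J hJ hJ' _ => hJ.eq_zero_of_isHyperfield hJ'⟩
  have : (1 : R) ∈ ({0} : Set R) := h ▸ Set.mem_univ _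
  exact one_ne_zero (Set.mem_singleton_iff.1 this)

end Ideals

theorem isMaximalIdeal_preimage_iso {R S : HyperringCat.{u}} (e : R ≅ S) {I : Set S}
    (hI : IsMaximalIdeal I) : IsMaximalIdeal (e.hom ⁻¹' I) where
  isIdeal := hI.isIdeal.preimage (HyperringCat.Hom.hom e.hom)
  ne_univ h := hI.ne_univ (hI.isIdeal.eq_univ_of_one_mem (by
    have : (1 : R) ∈ e.hom ⁻¹' I := h ▸ Set.mem_univ _
    rw [Set.mem_preimage] at this
    rwa [map_one (HyperringCat.Hom.hom e.hom)] at this))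
  eq_of_subset J hJ hJ' hIJ := by
    have h1 := hI.eq_of_subset (e.inv ⁻¹' J) (hJ.preimage (HyperringCat.Hom.hom e.inv)) (by
      intro h
      refine hJ' (hJ.eq_univ_of_one_mem ?_)
      have : (1 : S) ∈ e.inv ⁻¹' J := h ▸ Set.mem_univ _
      rw [Set.mem_preimage] at this
      rwa [map_one (HyperringCat.Hom.hom e.inv)] at this) (by
      intro s hs
      apply hIJ
      rw [Set.mem_preimage]
      simpa using hs)
    rw [← h1, ← Set.preimage_comp]
    ext r
    simp

theorem existsUnique_isMaximalIdeal_of_iso {R S : HyperringCat.{u}} (e : R ≅ S)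
    (h : ∃! I : Set S, IsMaximalIdeal I) : ∃! I : Set R, IsMaximalIdeal I := by
  obtain ⟨I, hI, hu⟩ := h
  refine ⟨e.hom ⁻¹' I, isMaximalIdeal_preimage_iso e hI, fun J hJ => ?_⟩
  rw [← hu _ (isMaximalIdeal_preimage_iso e.symm hJ)]
  ext r
  simp

/-- Ideals of a commutative ring, viewed as a hyperring, are the usual ideals. -/
theorem isIdeal_ring_iff (A : CommRingCat.{u}) (I : Set (ringToHyperring.obj A)) :
    IsIdeal I ↔ ∃ J : Ideal A, (J : Set A) = I := by
  constructor
  · intro h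
    exact ⟨{ carrier := I
             add_mem' := fun {a b} ha hb => h.hadd_subset a ha b hb rfl
             zero_mem' := h.zero_mem
             smul_mem' := fun r a ha => h.mul_mem r a ha }, rfl⟩
  · rintro ⟨J, rfl⟩
    exact ⟨J.zero_mem, by rintro a ha b hb _ rfl; exact J.add_mem ha hb,
      fun a ha => J.neg_mem ha, fun r a ha => J.mul_mem_left r ha⟩

theorem isMaximalIdeal_ring_iff (A : CommRingCat.{u}) (I : Set (ringToHyperring.obj A)) :
    IsMaximalIdeal I ↔ ∃ J : Ideal A, J.IsMaximal ∧ (J : Set A) = I := by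
  constructor
  · intro h
    obtain ⟨J, rfl⟩ := (isIdeal_ring_iff A I).1 h.isIdeal
    refine ⟨J, Ideal.isMaximal_def.2 ⟨fun hJ => h.ne_univ (by rw [hJ]; rfl), ?_⟩, rfl⟩
    intro K hK
    by_contra hK'
    have := h.eq_of_subset (K : Set A) ((isIdeal_ring_iff A _).2 ⟨K, rfl⟩)
      (fun h => hK' ((Ideal.eq_top_iff_one _).2 (show (1 : A) ∈ (_ : Set A) from h ▸ Set.mem_univ _))) hK.le
    exact hK.ne (SetLike.coe_injective this).symm
  · rintro ⟨J, hJ, rfl⟩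
    refine ⟨(isIdeal_ring_iff A _).2 ⟨J, rfl⟩, fun h => hJ.ne_top
      ((Ideal.eq_top_iff_one _).2 (show (1 : A) ∈ (_ : Set A) from h ▸ Set.mem_univ _)), fun K hK hK' h => ?_⟩
    obtain ⟨K, rfl⟩ := (isIdeal_ring_iff A K).1 hK
    rw [hJ.eq_of_le (fun h => hK' (by rw [h]; rfl)) h]

/-! ### The tropical hyperfield -/

/-- The set `ℝ ∪ {-∞}` underlying the tropical hyperfield. -/
@[ext]
structure Trop : Type u where
  /-- The element as a member of `ℝ ∪ {-∞}`. -/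
  val : WithBot ℝ

namespace Trop

/-- Hyperaddition on `ℝ ∪ {-∞}`: the maximum of two distinct elements, and `[-∞, x]` for
`x ⊞ x`. -/
def haddBot (x y : WithBot ℝ) : Set (WithBot ℝ) :=
  open Classical in if x = y then Set.Iic x else {max x y}

theorem mem_haddBot {x y z : WithBot ℝ} :
    z ∈ haddBot x y ↔ z ≤ max x y ∧ x ≤ max y z ∧ y ≤ max x z := by
  unfold haddBot
  split_ifs with h
  · subst h
    simp
  · rw [Set.mem_singleton_iff]
    rcases lt_or_gt_of_ne h with h | h
    · rw [max_eq_right h.le]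
      constructor
      · rintro rfl
        simp [h.le]
      · rintro ⟨h1, -, h3⟩
        exact le_antisymm h1 ((le_max_iff.1 h3).resolve_left h.not_ge)
    · rw [max_eq_left h.le]
      constructor
      · rintro rfl
        simp [h.le]
      · rintro ⟨h1, h3, -⟩
        exact le_antisymm h1 ((le_max_iff.1 h3).resolve_left h.not_ge)

theorem haddBot_assoc_aux {x y z t w : WithBot ℝ} (hw : w ∈ haddBot x y)
    (ht : t ∈ haddBot w z) : ∃ v ∈ haddBot y z, t ∈ haddBot x v := by
  simp only [mem_haddBot, le_max_iff] at hw ht ⊢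
  by_cases h1 : y = z
  · by_cases h2 : x = t
    · exact ⟨min x y, by grind⟩
    · exact ⟨max x t, by grind⟩
  · rcases lt_or_gt_of_ne h1 with h | h
    · exact ⟨z, by grind⟩
    · exact ⟨y, by grind⟩

theorem add_mem_haddBot {x y z : WithBot ℝ} {r : ℝ} :
    (r : WithBot ℝ) + z ∈ haddBot (r + x) (r + y) ↔ z ∈ haddBot x y := by
  have h : ∀ a b : WithBot ℝ, (r : WithBot ℝ) + a ≤ r + b ↔ a ≤ b := fun a b =>
    WithBot.add_le_add_iff_left WithBot.coe_ne_bot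
  simp only [mem_haddBot, le_max_iff, h]

/-- The tropical hyperfield: multiplication is addition in `ℝ ∪ {-∞}`, the zero is `-∞`, the one
is the real number `0`. -/
noncomputable instance : Hyperring Trop.{u} where
  mul a b := ⟨a.val + b.val⟩
  one := ⟨((0 : ℝ) : WithBot ℝ)⟩
  zero := ⟨⊥⟩
  neg a := a
  mul_assoc a b c := Trop.ext (add_assoc _ _ _)
  mul_comm a b := Trop.ext (add_comm _ _)
  one_mul a := Trop.ext (zero_add _)
  mul_one a := Trop.ext (add_zero _)
  zero_mul a := Trop.ext (WithBot.bot_add _)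
  mul_zero a := Trop.ext (WithBot.add_bot _)
  hadd a b := {c | c.val ∈ haddBot a.val b.val}
  hadd_nonempty a b := ⟨⟨max a.val b.val⟩, mem_haddBot.2 (by simp)⟩
  hadd_comm a b := by
    ext c
    change c.val ∈ haddBot _ _ ↔ c.val ∈ haddBot _ _
    simp only [mem_haddBot, max_comm]
    tauto
  hadd_assoc a b c := by
    have comm : ∀ x y z : WithBot ℝ, z ∈ haddBot x y → z ∈ haddBot y x := by
      intro x y z
      simp only [mem_haddBot, max_comm]
      tauto
    ext t
    simp only [Set.mem_iUnion, exists_prop]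
    constructor
    · rintro ⟨w, hw, ht⟩
      obtain ⟨v, hv, hv'⟩ := haddBot_assoc_aux hw ht
      exact ⟨⟨v⟩, hv, hv'⟩
    · rintro ⟨w, hw, ht⟩
      obtain ⟨v, hv, hv'⟩ := haddBot_assoc_aux (comm _ _ _ hw) (comm _ _ _ ht)
      exact ⟨⟨v⟩, comm _ _ _ hv, comm _ _ _ hv'⟩
  zero_hadd a := by
    ext c
    change c.val ∈ haddBot ⊥ a.val ↔ _
    rw [mem_haddBot, Set.mem_singleton_iff, Trop.ext_iff]
    simp only [bot_le, true_and, max_bot_left]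
    exact ⟨fun h => le_antisymm h.1 h.2, fun h => ⟨h.le, h.ge⟩⟩
  zero_mem_hadd_iff a b := by
    change ⊥ ∈ haddBot a.val b.val ↔ b = a
    rw [mem_haddBot, Trop.ext_iff]
    simp only [bot_le, true_and, max_bot_right]
    exact ⟨fun h => le_antisymm h.2 h.1, fun h => ⟨h.ge, h.le⟩⟩
  reversible a b c h := by
    change b.val ∈ haddBot a.val c.val
    have h : a.val ∈ haddBot b.val c.val := h
    simp only [mem_haddBot, le_max_iff] at h ⊢
    tauto
  mul_hadd a b c := by
    ext d
    change (∃ t : Trop, t.val ∈ haddBot b.val c.val ∧ (⟨a.val + t.val⟩ : Trop) = d) ↔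
      d.val ∈ haddBot (a.val + b.val) (a.val + c.val)
    obtain ⟨a⟩ := a
    obtain ⟨d⟩ := d
    induction a using WithBot.recBotCoe with
    | bot =>
      simp only [WithBot.bot_add, Trop.mk.injEq, mem_haddBot, max_self, le_bot_iff, bot_le, and_true]
      constructor
      · rintro ⟨_, _, h⟩
        exact h.symm
      · rintro rfl
        exact ⟨⟨max b.val c.val⟩, by simp, rfl⟩
    | coe r =>
      constructor
      · rintro ⟨t, ht, h⟩
        obtain rfl := congrArg Trop.val h
        exact add_mem_haddBot.2 ht
      · intro h
        have hd : (r : WithBot ℝ) + (((-r : ℝ) : WithBot ℝ) + d) = d := by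
          rw [← add_assoc, ← WithBot.coe_add, add_neg_cancel, WithBot.coe_zero, zero_add]
        refine ⟨⟨((-r : ℝ) : WithBot ℝ) + d⟩, ?_, Trop.ext hd⟩
        rw [← add_mem_haddBot (r := r), hd]
        exact h

instance : IsHyperfield Trop.{u} where
  exists_pair_ne := ⟨⟨⊥⟩, ⟨((0 : ℝ) : WithBot ℝ)⟩, fun h => WithBot.bot_ne_coe (congrArg Trop.val h)⟩
  exists_mul_eq_one := by
    rintro ⟨a⟩ h
    induction a using WithBot.recBotCoe with
    | bot => exact (h rfl).elim
    | coe r =>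
      refine ⟨⟨((-r : ℝ) : WithBot ℝ)⟩, Trop.ext ?_⟩
      change ((r : ℝ) : WithBot ℝ) + ((-r : ℝ) : WithBot ℝ) = ((0 : ℝ) : WithBot ℝ)
      rw [← WithBot.coe_add, add_neg_cancel]

/-- The Euclidean topology on `ℝ ∪ {-∞} ≃ [0, ∞)`, which is the order topology. -/
instance : TopologicalSpace Trop.{u} :=
  TopologicalSpace.induced Trop.val (Preorder.topology (WithBot ℝ))

/-- The logarithm `[0, ∞) → ℝ ∪ {-∞}` with `log 0 = -∞`, which passes from the multiplicative to
the additive notation for valuations. -/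
noncomputable def log (r : ℝ) : Trop.{u} :=
  ⟨open Classical in if r = 0 then ⊥ else (Real.log r : WithBot ℝ)⟩

theorem log_zero : log.{u} 0 = 0 := by
  simp only [log, if_true]
  rfl

theorem log_one : log.{u} 1 = 1 := by
  simp only [log, one_ne_zero, if_false, Real.log_one]
  rfl

theorem log_mul (r s : ℝ) : log.{u} (r * s) = log r * log s := by
  apply Trop.ext
  change (log (r * s)).val = (log r).val + (log s).val
  by_cases hr : r = 0
  · simp [log, hr]
  by_cases hs : s = 0
  · simp [log, hs]
  simp [log, hr, hs, Real.log_mul hr hs]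

theorem log_le_log {r s : ℝ} (hr : 0 ≤ r) (h : r ≤ s) : (log.{u} r).val ≤ (log.{u} s).val := by
  by_cases hr0 : r = 0
  · simp [log, hr0]
  have hr' : 0 < r := lt_of_le_of_ne hr (Ne.symm hr0)
  simp only [log, hr0, (hr'.trans_le h).ne', if_false, WithBot.coe_le_coe]
  exact Real.log_le_log hr' h

end Trop

/-- The valuation `ν = log ‖·‖` of a non-Archimedean normed field, as a homomorphism of hyperrings
to the tropical hyperfield. -/
noncomputable def valuationHom (k : Type u) [NormedField k] [IsUltrametricDist k] :
    ringToHyperring.obj (CommRingCat.of k) ⟶ HyperringCat.of Trop.{u} :=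
  ⟨{ toFun := fun c : k => Trop.log ‖c‖
     map_zero' := (congrArg Trop.log (norm_zero (E := k))).trans Trop.log_zero
     map_one' := (congrArg Trop.log (norm_one (α := k))).trans Trop.log_one
     map_mul' := fun a b : k => (congrArg Trop.log (norm_mul a b)).trans (Trop.log_mul _ _)
     map_hadd' := by
      rintro (a : k) (b : k) _ rfl
      have key : ∀ x y : k, (Trop.log.{u} ‖x + y‖).val ≤
          max (Trop.log.{u} ‖x‖).val (Trop.log.{u} ‖y‖).val := by
        intro x y
        rcases le_max_iff.1 (IsUltrametricDist.norm_add_le_max x y) with h | h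
        · exact le_max_of_le_left (Trop.log_le_log (norm_nonneg _) h)
        · exact le_max_of_le_right (Trop.log_le_log (norm_nonneg _) h)
      refine Trop.mem_haddBot.2 ⟨key a b, ?_, ?_⟩
      · have := key (-b) (a + b)
        rwa [neg_add_cancel_comm_assoc, norm_neg] at this
      · have := key (-a) (a + b)
        rwa [neg_add_cancel_left, norm_neg] at this }⟩

/-! ### Locally hyperringed spaces -/

/-- The diagram of the sections of a presheaf of hyperrings over the open neighbourhoods of `x`,
whose colimit is the stalk at `x`. -/
abbrev stalkDiagram {X : TopCat.{u}} (F : X.Presheaf HyperringCat.{u}) (x : X) :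
    (OpenNhds x)ᵒᵖ ⥤ HyperringCat.{u} :=
  (OpenNhds.inclusion x).op ⋙ F

/-- A locally hyperringed space: a topological space with a sheaf of hyperrings, such that the
stalks exist (as colimits in the category of hyperrings) and have a unique maximal ideal. -/
structure LocallyHyperringedSpace extends PresheafedSpace HyperringCat.{u} where
  isSheaf : TopCat.Presheaf.IsSheaf (presheaf ⋙ forget HyperringCat.{u})
  hasStalk : ∀ x : carrier, HasColimit (stalkDiagram presheaf x)
  existsUnique_maximal : ∀ x : carrier, haveI := hasStalk x
    ∃! m : Set (colimit (stalkDiagram presheaf x)).carrier, IsMaximalIdeal m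

namespace LocallyHyperringedSpace

attribute [instance] LocallyHyperringedSpace.hasStalk

/-- The stalk at a point. -/
noncomputable abbrev stalk (X : LocallyHyperringedSpace.{u}) (x : X.carrier) : HyperringCat.{u} :=
  colimit (stalkDiagram X.presheaf x)

/-- The germ at `x` of a section over a neighbourhood of `x`. -/
noncomputable abbrev germ (X : LocallyHyperringedSpace.{u}) (x : X.carrier) (U : OpenNhds x) :
    X.presheaf.obj (op U.1) ⟶ X.stalk x :=
  colimit.ι (stalkDiagram X.presheaf x) (op U)

/-- The map on stalks induced by a morphism of spaces with presheaves of hyperrings. -/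
noncomputable def stalkMap {X Y : LocallyHyperringedSpace.{u}}
    (f : X.toPresheafedSpace ⟶ Y.toPresheafedSpace) (x : X.carrier) :
    Y.stalk (f.base x) ⟶ X.stalk x :=
  colimit.desc (stalkDiagram Y.presheaf (f.base x))
    { pt := X.stalk x
      ι :=
        { app := fun U => f.c.app (op U.unop.1) ≫
            X.germ x ((OpenNhds.map f.base x).obj U.unop)
          naturality := by
            intro U V i
            have h1 := f.c.naturality ((OpenNhds.inclusion (f.base x)).map i.unop).op
            have h2 := colimit.w (stalkDiagram X.presheaf x) ((OpenNhds.map f.base x).map i.unop).op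
            dsimp only [Functor.const_obj_map]
            erw [Category.comp_id, ← Category.assoc, h1, Category.assoc]
            congr 1 } }

theorem germ_stalkMap {X Y : LocallyHyperringedSpace.{u}}
    (f : X.toPresheafedSpace ⟶ Y.toPresheafedSpace) (x : X.carrier) (U : OpenNhds (f.base x)) :
    Y.germ (f.base x) U ≫ stalkMap f x =
      f.c.app (op U.1) ≫ X.germ x ((OpenNhds.map f.base x).obj U) :=
  colimit.ι_desc _ _

/-- A morphism of locally hyperringed spaces: a continuous map with a morphism of sheaves of
hyperrings, such that the induced maps on stalks are local. -/
@[ext]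
structure Hom (X Y : LocallyHyperringedSpace.{u}) where
  /-- The underlying morphism of spaces with presheaves. -/
  toPsh : X.toPresheafedSpace ⟶ Y.toPresheafedSpace
  isLocal : ∀ (x : X.carrier) (m : Set (X.stalk x)), IsMaximalIdeal m →
    IsMaximalIdeal (stalkMap toPsh x ⁻¹' m)

theorem stalkMap_id (X : LocallyHyperringedSpace.{u}) (x : X.carrier) :
    stalkMap (𝟙 X.toPresheafedSpace) x = 𝟙 (X.stalk x) := by
  apply colimit.hom_ext
  intro U
  refine (germ_stalkMap (X := X) (Y := X) (𝟙 X.toPresheafedSpace) x U.unop).trans ?_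
  rfl

theorem stalkMap_comp {X Y Z : LocallyHyperringedSpace.{u}}
    (f : X.toPresheafedSpace ⟶ Y.toPresheafedSpace)
    (g : Y.toPresheafedSpace ⟶ Z.toPresheafedSpace) (x : X.carrier) :
    stalkMap (X := X) (Y := Z) (f ≫ g) x =
      stalkMap (X := Y) (Y := Z) g (f.base x) ≫ stalkMap (X := X) (Y := Y) f x := by
  apply colimit.hom_ext
  intro U
  have h1 := germ_stalkMap (X := X) (Y := Z) (f ≫ g) x U.unop
  have h2 := germ_stalkMap (X := Y) (Y := Z) g (f.base x) U.unop
  have h3 := germ_stalkMap (X := X) (Y := Y) f x ((OpenNhds.map g.base (f.base x)).obj U.unop)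
  refine h1.trans ?_
  refine Eq.trans ?_ (Category.assoc _ _ _)
  refine Eq.trans ?_ (congrArg (· ≫ stalkMap (X := X) (Y := Y) f x) h2).symm
  refine Eq.trans ?_ (Category.assoc _ _ _).symm
  refine Eq.trans ?_ (congrArg (g.c.app (op U.unop.1) ≫ ·) h3).symm
  exact Category.assoc _ _ _

instance : Category LocallyHyperringedSpace.{u} where
  Hom := Hom
  id X := ⟨𝟙 X.toPresheafedSpace, fun x m hm => by
    rw [stalkMap_id]
    exact hm⟩
  comp {X Y Z} f g := ⟨f.toPsh ≫ g.toPsh, fun x m hm => by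
    rw [stalkMap_comp]
    exact g.isLocal _ _ (f.isLocal x m hm)⟩
  id_comp f := Hom.ext (Category.id_comp f.toPsh)
  comp_id f := Hom.ext (Category.comp_id f.toPsh)
  assoc f g h := Hom.ext (Category.assoc f.toPsh g.toPsh h.toPsh)

end LocallyHyperringedSpace

/-! ### Schemes as locally hyperringed spaces -/

section RingStalk

variable {X : TopCat.{u}} (F : X.Presheaf CommRingCat.{u}) (x : X)

/-- The stalk of a presheaf of rings, as a cocone in the category of hyperrings. -/
noncomputable def ringStalkCocone : Cocone (stalkDiagram (F ⋙ ringToHyperring) x) :=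
  ringToHyperring.mapCocone (colimit.cocone ((OpenNhds.inclusion x).op ⋙ F))

theorem exists_germ_common (a b : F.stalk x) :
    ∃ (U : OpenNhds x) (a' b' : F.obj (op U.1)),
      F.germ U.1 x U.2 a' = a ∧ F.germ U.1 x U.2 b' = b := by
  obtain ⟨U, hU, a', rfl⟩ := F.exists_germ_eq a
  obtain ⟨V, hV, b', rfl⟩ := F.exists_germ_eq b
  refine ⟨⟨U ⊓ V, hU, hV⟩, F.map (homOfLE inf_le_left).op a', F.map (homOfLE inf_le_right).op b',
    ?_, ?_⟩
  · exact F.germ_res_apply (homOfLE inf_le_left) x ⟨hU, hV⟩ a'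
  · exact F.germ_res_apply (homOfLE inf_le_right) x ⟨hU, hV⟩ b'

/-- A section of `F` over `U` followed by a cocone map only depends on the germ. -/
theorem cocone_eq_of_germ_eq (s : Cocone (stalkDiagram (F ⋙ ringToHyperring) x))
    (U V : OpenNhds x) (a : F.obj (op U.1)) (b : F.obj (op V.1))
    (h : F.germ U.1 x U.2 a = F.germ V.1 x V.2 b) :
    HyperringCat.Hom.hom (s.ι.app (op U)) a = HyperringCat.Hom.hom (s.ι.app (op V)) b := by
  obtain ⟨W, hW, iU, iV, e⟩ := F.germ_eq x U.2 V.2 a b h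
  have hU := s.w
    (homOfLE (show (⟨W, hW⟩ : OpenNhds x) ≤ U from iU.le)).op
  have hV := s.w
    (homOfLE (show (⟨W, hW⟩ : OpenNhds x) ≤ V from iV.le)).op
  have hU' := congrArg (fun g => HyperringCat.Hom.hom g a) hU
  have hV' := congrArg (fun g => HyperringCat.Hom.hom g b) hV
  refine hU'.symm.trans (Eq.trans ?_ hV')
  exact congrArg (HyperringCat.Hom.hom (s.ι.app (op ⟨W, hW⟩))) e

/-- The map out of the stalk induced by a cocone of hyperrings. -/
noncomputable def ringStalkDesc (s : Cocone (stalkDiagram (F ⋙ ringToHyperring) x)) :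
    ringToHyperring.obj (F.stalk x) ⟶ s.pt :=
  have h := fun a : F.stalk x => F.exists_germ_eq a
  let f : F.stalk x → s.pt := fun a =>
    HyperringCat.Hom.hom (s.ι.app (op ⟨(h a).choose, (h a).choose_spec.choose⟩))
      (h a).choose_spec.choose_spec.choose
  have hf : ∀ (U : OpenNhds x) (a : F.obj (op U.1)),
      f (F.germ U.1 x U.2 a) = HyperringCat.Hom.hom (s.ι.app (op U)) a := fun U a =>
    cocone_eq_of_germ_eq F x s _ _ _ _ (h (F.germ U.1 x U.2 a)).choose_spec.choose_spec.choose_spec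
  ⟨{ toFun := f
     map_zero' := by
      have := hf ⊤ 0
      rw [map_zero] at this
      exact this.trans (map_zero (HyperringCat.Hom.hom (s.ι.app (op ⊤))))
     map_one' := by
      have := hf ⊤ 1
      rw [map_one] at this
      exact this.trans (map_one (HyperringCat.Hom.hom (s.ι.app (op ⊤))))
     map_mul' := by
      intro a b
      obtain ⟨U, a, b, rfl, rfl⟩ := exists_germ_common F x a b
      have := hf U (a * b)
      rw [map_mul] at this
      refine this.trans ?_
      rw [hf, hf]
      exact map_mul (HyperringCat.Hom.hom (s.ι.app (op U))) a b
     map_hadd' := by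
      rintro a b _ rfl
      obtain ⟨U, a, b, rfl, rfl⟩ := exists_germ_common F x a b
      have := hf U (a + b)
      rw [map_add] at this
      refine Set.mem_of_eq_of_mem this ?_
      rw [hf, hf]
      exact HyperringHom.map_hadd (HyperringCat.Hom.hom (s.ι.app (op U))) rfl }⟩

theorem ringStalkDesc_germ (s : Cocone (stalkDiagram (F ⋙ ringToHyperring) x)) (U : OpenNhds x)
    (a : F.obj (op U.1)) :
    HyperringCat.Hom.hom (ringStalkDesc F x s) (F.germ U.1 x U.2 a) =
      HyperringCat.Hom.hom (s.ι.app (op U)) a :=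
  cocone_eq_of_germ_eq F x s _ _ _ _
    (F.exists_germ_eq (F.germ U.1 x U.2 a)).choose_spec.choose_spec.choose_spec

/-- The stalk in the category of rings is the stalk in the category of hyperrings. -/
noncomputable def ringStalkIsColimit : IsColimit (ringStalkCocone F x) where
  desc s := ringStalkDesc F x s
  fac s U := by
    apply ConcreteCategory.hom_ext
    intro a
    exact ringStalkDesc_germ F x s U.unop a
  uniq s m hm := by
    apply ConcreteCategory.hom_ext
    intro a
    obtain ⟨U, hU, a, rfl⟩ := F.exists_germ_eq (x := x) a
    refine Eq.trans ?_ (ringStalkDesc_germ F x s ⟨U, hU⟩ a).symm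
    rw [← hm]
    rfl

end RingStalk

theorem existsUnique_maximal_of_isLocalRing (A : CommRingCat.{u}) [IsLocalRing A] :
    ∃! m : Set (ringToHyperring.obj A), IsMaximalIdeal m := by
  refine ⟨(IsLocalRing.maximalIdeal A : Set A), (isMaximalIdeal_ring_iff A _).2
    ⟨_, IsLocalRing.maximalIdeal.isMaximal A, rfl⟩, fun I hI => ?_⟩
  obtain ⟨J, hJ, rfl⟩ := (isMaximalIdeal_ring_iff A I).1 hI
  rw [IsLocalRing.eq_maximalIdeal hJ]

instance hasColimit_ringStalk {X : TopCat.{u}} (F : X.Presheaf CommRingCat.{u}) (x : X) :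
    HasColimit (stalkDiagram (F ⋙ ringToHyperring) x) :=
  ⟨⟨ringStalkCocone F x, ringStalkIsColimit F x⟩⟩

/-- A scheme, as a locally hyperringed space. -/
noncomputable def schemeToLHSObj (X : Scheme.{u}) : LocallyHyperringedSpace.{u} where
  carrier := X.carrier
  presheaf := X.presheaf ⋙ ringToHyperring
  isSheaf := (TopCat.Presheaf.isSheaf_iff_isSheaf_comp (forget CommRingCat.{u}) X.presheaf).1
    X.IsSheaf
  hasStalk x := hasColimit_ringStalk X.presheaf x
  existsUnique_maximal x := existsUnique_isMaximalIdeal_of_iso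
    ((colimit.isColimit _).coconePointUniqueUpToIso (ringStalkIsColimit X.presheaf x))
    (existsUnique_maximal_of_isLocalRing (X.presheaf.stalk x))

/-- The stalk of a scheme as a locally hyperringed space is the usual stalk. -/
noncomputable def schemeStalkIso (X : Scheme.{u}) (x : X) :
    (schemeToLHSObj X).stalk x ≅ ringToHyperring.obj (X.presheaf.stalk x) :=
  (colimit.isColimit (stalkDiagram (X.presheaf ⋙ ringToHyperring) x)).coconePointUniqueUpToIso
    (ringStalkIsColimit X.presheaf x)

theorem germ_schemeStalkIso_hom (X : Scheme.{u}) (x : X) (U : OpenNhds x) :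
    (schemeToLHSObj X).germ x U ≫ (schemeStalkIso X x).hom =
      ringToHyperring.map (X.presheaf.germ U.1 x U.2) :=
  (colimit.isColimit (stalkDiagram (X.presheaf ⋙ ringToHyperring) x)).comp_coconePointUniqueUpToIso_hom
    (ringStalkIsColimit X.presheaf x) (op U)

/-- A morphism of schemes, on the underlying spaces with presheaves of hyperrings. -/
noncomputable def schemeToLHSMapPsh {X Y : Scheme.{u}} (f : X ⟶ Y) :
    (schemeToLHSObj X).toPresheafedSpace ⟶ (schemeToLHSObj Y).toPresheafedSpace :=
  ringToHyperring.mapPresheaf.map f.toLRSHom.toHom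

theorem stalkMap_schemeStalkIso {X Y : Scheme.{u}} (f : X ⟶ Y) (x : X) :
    LocallyHyperringedSpace.stalkMap (schemeToLHSMapPsh f) x ≫ (schemeStalkIso X x).hom =
      (schemeStalkIso Y (f x)).hom ≫ ringToHyperring.map (f.stalkMap x) := by
  apply colimit.hom_ext
  intro U
  have h1 := LocallyHyperringedSpace.germ_stalkMap (schemeToLHSMapPsh f) x U.unop
  have h2 := germ_schemeStalkIso_hom X x ((OpenNhds.map f.base x).obj U.unop)
  have h3 := germ_schemeStalkIso_hom Y (f x) U.unop
  have h4 := f.germ_stalkMap U.unop.1 x U.unop.2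
  refine (Category.assoc _ _ _).symm.trans ?_
  refine (congrArg (· ≫ (schemeStalkIso X x).hom) h1).trans ?_
  refine (Category.assoc _ _ _).trans ?_
  refine (congrArg ((schemeToLHSMapPsh f).c.app (op U.unop.1) ≫ ·) h2).trans ?_
  refine Eq.trans ?_ (Category.assoc _ _ _)
  refine Eq.trans ?_ (congrArg (· ≫ ringToHyperring.map (f.stalkMap x)) h3).symm
  exact (congrArg ringToHyperring.map h4).symm

theorem isLocal_schemeToLHSMapPsh {X Y : Scheme.{u}} (f : X ⟶ Y) (x : X)
    (m : Set ((schemeToLHSObj X).stalk x)) (hm : IsMaximalIdeal m) :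
    IsMaximalIdeal (LocallyHyperringedSpace.stalkMap (schemeToLHSMapPsh f) x ⁻¹' m) := by
  have h1 := isMaximalIdeal_preimage_iso (schemeStalkIso X x).symm hm
  obtain ⟨J, hJ, hJ'⟩ := (isMaximalIdeal_ring_iff _ _).1 h1
  have h2 : IsMaximalIdeal (R := ringToHyperring.obj (Y.presheaf.stalk (f x)))
      ((f.stalkMap x).hom ⁻¹' (J : Set (X.presheaf.stalk x))) := by
    refine (isMaximalIdeal_ring_iff _ _).2 ⟨J.comap (f.stalkMap x).hom, ?_, rfl⟩
    have hloc : IsLocalHom (f.stalkMap x).hom := inferInstance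
    have hcomap : (IsLocalRing.maximalIdeal (X.presheaf.stalk x)).comap (f.stalkMap x).hom =
        IsLocalRing.maximalIdeal (Y.presheaf.stalk (f x)) :=
      ((IsLocalRing.local_hom_TFAE (f.stalkMap x).hom).out 0 4).1 hloc
    rw [IsLocalRing.eq_maximalIdeal hJ, hcomap]
    exact IsLocalRing.maximalIdeal.isMaximal _
  have h3 := isMaximalIdeal_preimage_iso (schemeStalkIso Y (f x)) h2
  have h5 := (Iso.eq_comp_inv _).2 (stalkMap_schemeStalkIso f x)
  have h4 : LocallyHyperringedSpace.stalkMap (schemeToLHSMapPsh f) x ⁻¹' m =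
      (schemeStalkIso Y (f x)).hom ⁻¹'
        ((f.stalkMap x).hom ⁻¹' (J : Set (X.presheaf.stalk x))) := by
    rw [hJ']
    ext a
    exact iff_of_eq (congrArg (fun g => HyperringCat.Hom.hom g a ∈ m) h5)
  rw [h4]
  exact h3

/-- The inclusion of schemes into locally hyperringed spaces. -/
noncomputable def schemeToLHS : Scheme.{u} ⥤ LocallyHyperringedSpace.{u} where
  obj X := schemeToLHSObj X
  map f := ⟨schemeToLHSMapPsh f, isLocal_schemeToLHSMapPsh f⟩
  map_id _ := LocallyHyperringedSpace.Hom.ext (ringToHyperring.mapPresheaf.map_id _)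
  map_comp _ _ := LocallyHyperringedSpace.Hom.ext (ringToHyperring.mapPresheaf.map_comp _ _)

/-! ### The spectrum of a hyperfield -/

/-- The prime ideals of a hyperring. -/
@[ext]
structure HyperSpec (R : Type u) [Hyperring R] : Type u where
  /-- The underlying set of the prime ideal. -/
  ideal : Set R
  isPrime : IsPrimeIdeal ideal

/-- The Zariski topology on the prime ideals of a hyperring, generated by the sets of the primes
that do not contain a given element. -/
instance (R : Type u) [Hyperring R] : TopologicalSpace (HyperSpec R) :=
  TopologicalSpace.generateFrom (Set.range fun a : R => {p : HyperSpec R | a ∉ p.ideal})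

section Hyperfield

variable (H : Type u) [Hyperring H] [IsHyperfield H]

/-- A hyperfield has exactly one prime ideal, namely `{0}`. -/
instance HyperSpec.unique : Unique (HyperSpec H) where
  default := ⟨{0}, isIdeal_zero, fun h => one_ne_zero (Set.mem_singleton_iff.1 h), by
    intro a b h
    by_cases ha : a = 0
    · exact Or.inl ha
    · obtain ⟨c, hc⟩ := IsHyperfield.exists_mul_eq_one a ha
      refine Or.inr (Set.mem_singleton_iff.2 ?_)
      rw [Set.mem_singleton_iff] at h
      rw [← one_mul b, ← hc, mul_comm a c, mul_assoc, h, mul_zero]⟩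
  uniq p := HyperSpec.ext (p.isPrime.isIdeal.eq_zero_of_isHyperfield fun h =>
    p.isPrime.one_notMem (h ▸ Set.mem_univ _))

/-- The structure presheaf of `Spec H`: the localization of the hyperfield `H` at its only prime
ideal is `H`, so the sections over `U` are the functions `U → H`. -/
def hyperSpecPresheaf : (TopCat.of (HyperSpec H)).Presheaf HyperringCat.{u} where
  obj U := HyperringCat.of (U.unop → H)
  map {U V} i := ⟨
    { toFun := fun (g : U.unop → H) (y : V.unop) => g ⟨y.1, i.unop.le y.2⟩
      map_zero' := rfl
      map_one' := rfl
      map_mul' := fun _ _ => rfl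
      map_hadd' := fun _ _ _ h y => h ⟨y.1, i.unop.le y.2⟩ }⟩
  map_id _ := rfl
  map_comp _ _ := rfl

/-- Evaluation of sections over neighbourhoods of `x`. -/
def hyperSpecStalkCocone (x : TopCat.of (HyperSpec H)) :
    Cocone (stalkDiagram (hyperSpecPresheaf H) x) where
  pt := HyperringCat.of H
  ι :=
    { app := fun U => ⟨
        { toFun := fun g : U.unop.1 → H => g ⟨x, U.unop.2⟩
          map_zero' := rfl
          map_one' := rfl
          map_mul' := fun _ _ => rfl
          map_hadd' := fun _ _ _ h => h ⟨x, U.unop.2⟩ }⟩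
      naturality := fun _ _ _ => rfl }

/-- Constant functions as global sections. -/
def hyperSpecConst (x : TopCat.of (HyperSpec H)) :
    HyperringCat.of H ⟶ (stalkDiagram (hyperSpecPresheaf H) x).obj (op ⊤) :=
  ⟨{ toFun := fun c _ => c
     map_zero' := rfl
     map_one' := rfl
     map_mul' := fun _ _ => rfl
     map_hadd' := fun _ _ _ h _ => h }⟩

/-- The stalk of the structure sheaf of `Spec H` is `H`. -/
def hyperSpecStalkIsColimit (x : TopCat.of (HyperSpec H)) :
    IsColimit (hyperSpecStalkCocone H x) where
  desc s := hyperSpecConst H x ≫ s.ι.app (op ⊤)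
  fac s U := by
    apply ConcreteCategory.hom_ext
    intro (g : U.unop.1 → H)
    have h := congrArg (fun f => HyperringCat.Hom.hom f (fun _ => g ⟨x, U.unop.2⟩))
      (s.w (homOfLE (le_top : U.unop ≤ ⊤)).op)
    refine h.symm.trans (congrArg (HyperringCat.Hom.hom (s.ι.app U)) ?_)
    funext y
    exact congrArg g (Subtype.ext (Subsingleton.elim (α := HyperSpec H) _ _))
  uniq s m hm := by
    apply ConcreteCategory.hom_ext
    intro (c : H)
    exact congrArg (fun f => HyperringCat.Hom.hom f (fun _ => c)) (hm (op ⊤))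

instance hasColimit_hyperSpec (x : TopCat.of (HyperSpec H)) :
    HasColimit (stalkDiagram (hyperSpecPresheaf H) x) :=
  ⟨⟨hyperSpecStalkCocone H x, hyperSpecStalkIsColimit H x⟩⟩

theorem existsUnique_maximal_of_isHyperfield : ∃! m : Set H, IsMaximalIdeal m :=
  ⟨{0}, isMaximalIdeal_iff_of_isHyperfield.2 rfl,
    fun _ h => isMaximalIdeal_iff_of_isHyperfield.1 h⟩

/-- The spectrum of a hyperfield, as a locally hyperringed space. -/
noncomputable def hyperfieldSpec : LocallyHyperringedSpace.{u} where
  carrier := TopCat.of (HyperSpec H)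
  presheaf := hyperSpecPresheaf H
  isSheaf := TopCat.Presheaf.toType_isSheaf (TopCat.of (HyperSpec H)) H
  hasStalk x := hasColimit_hyperSpec H x
  existsUnique_maximal x := existsUnique_isMaximalIdeal_of_iso
    ((colimit.isColimit _).coconePointUniqueUpToIso (hyperSpecStalkIsColimit H x))
    (existsUnique_maximal_of_isHyperfield H)

/-- The point of the spectrum of a hyperfield. -/
def hyperfieldSpecPt : (hyperfieldSpec H).carrier := (default : HyperSpec H)

/-- The stalk of `Spec H` is `H`. -/
noncomputable def hyperfieldSpecStalkIso (x : TopCat.of (HyperSpec H)) :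
    (hyperfieldSpec H).stalk x ≅ HyperringCat.of H :=
  (colimit.isColimit (stalkDiagram (hyperSpecPresheaf H) x)).coconePointUniqueUpToIso
    (hyperSpecStalkIsColimit H x)

end Hyperfield

/-! ### The structure morphism `Spec H ⟶ Spec k` -/

section StructureMap

variable {k : Type u} [Field k] {H : Type u} [Hyperring H] [IsHyperfield H]
  (φ : ringToHyperring.obj (CommRingCat.of k) ⟶ HyperringCat.of H)

theorem Spec_eq_top (U : (Spec (CommRingCat.of k)).Opens) (y : Spec (CommRingCat.of k))
    (hy : y ∈ U) : (⊤ : (Spec (CommRingCat.of k)).Opens) ≤ U := fun z _ => by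
  have : Subsingleton (PrimeSpectrum k) := inferInstance
  have h : z = y := Subsingleton.elim (α := PrimeSpectrum k) z y
  exact h ▸ hy

/-- The element of `k` given by a section of the structure sheaf of `Spec k` over a nonempty
open set. -/
noncomputable def SpecSectionToField (U : (Spec (CommRingCat.of k)).Opens)
    (y : Spec (CommRingCat.of k)) (hy : y ∈ U) :
    (Spec (CommRingCat.of k)).presheaf.obj (op U) ⟶ CommRingCat.of k :=
  (Spec (CommRingCat.of k)).presheaf.map (homOfLE (Spec_eq_top U y hy)).op ≫
    (Scheme.ΓSpecIso (CommRingCat.of k)).hom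

theorem map_SpecSectionToField {U V : (Spec (CommRingCat.of k)).Opens} (i : V ⟶ U)
    (y : Spec (CommRingCat.of k)) (hy : y ∈ V) :
    (Spec (CommRingCat.of k)).presheaf.map i.op ≫ SpecSectionToField V y hy =
      SpecSectionToField U y (i.le hy) := by
  unfold SpecSectionToField
  rw [← Category.assoc, ← Functor.map_comp]
  rfl

/-- The structure morphism on the underlying spaces with presheaves: a section of `Spec k` over a
nonempty open set is an element of `k`, and is sent to its image under `φ`. -/
noncomputable def structureMapPsh :
    (hyperfieldSpec H).toPresheafedSpace ⟶
      (schemeToLHSObj (Spec (CommRingCat.of k))).toPresheafedSpace where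
  base := TopCat.ofHom ⟨fun _ => (default : PrimeSpectrum k), continuous_const⟩
  c :=
    { app := fun U => ⟨
        { toFun := fun s y => HyperringCat.Hom.hom
            (ringToHyperring.map (SpecSectionToField U.unop _ y.2) ≫ φ) s
          map_zero' := funext fun y => map_zero (HyperringCat.Hom.hom
            (ringToHyperring.map (SpecSectionToField U.unop _ y.2) ≫ φ))
          map_one' := funext fun y => map_one (HyperringCat.Hom.hom
            (ringToHyperring.map (SpecSectionToField U.unop _ y.2) ≫ φ))
          map_mul' := fun a b => funext fun y => map_mul (HyperringCat.Hom.hom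
            (ringToHyperring.map (SpecSectionToField U.unop _ y.2) ≫ φ)) a b
          map_hadd' := fun _ _ _ h y => HyperringHom.map_hadd (HyperringCat.Hom.hom
            (ringToHyperring.map (SpecSectionToField U.unop _ y.2) ≫ φ)) h }⟩
      naturality := by
        intro U V i
        apply ConcreteCategory.hom_ext
        intro s
        funext y
        refine congrArg (HyperringCat.Hom.hom φ) ?_
        exact congrArg (fun f => f.hom s) (map_SpecSectionToField i.unop _ y.2) }

theorem isHyperfield_of_iso {R S : HyperringCat.{u}} (e : R ≅ S) [IsHyperfield S] :
    IsHyperfield R := by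
  have hinv : ∀ r : R, HyperringCat.Hom.hom e.inv (HyperringCat.Hom.hom e.hom r) = r := fun r =>
    congrArg (fun f => HyperringCat.Hom.hom f r) e.hom_inv_id
  refine { exists_pair_ne := ⟨0, 1, fun h => ?_⟩, exists_mul_eq_one := fun x hx => ?_ }
  · have h' := congrArg (HyperringCat.Hom.hom e.hom) h
    rw [map_zero, map_one] at h'
    exact zero_ne_one h'
  · have hx' : HyperringCat.Hom.hom e.hom x ≠ 0 := fun h => hx (by rw [← hinv x, h, map_zero])
    obtain ⟨y, hy⟩ := IsHyperfield.exists_mul_eq_one _ hx'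
    refine ⟨HyperringCat.Hom.hom e.inv y, ?_⟩
    have h := congrArg (HyperringCat.Hom.hom e.inv) hy
    rwa [map_mul, hinv, map_one] at h

theorem isUnit_stalk_Spec (R : CommRingCat.{u}) (hR : IsField R) (x : Spec R)
    (a : (Spec R).presheaf.stalk x) (ha : a ≠ 0) : IsUnit a := by
  have hx : x.asIdeal.IsPrime := PrimeSpectrum.isPrime x
  let _ : Algebra R ((Spec R).presheaf.stalk x) := StructureSheaf.stalkAlgebra R x
  have : IsLocalization.AtPrime ((Spec R).presheaf.stalk x) x.asIdeal :=
    StructureSheaf.IsLocalization.to_stalk R x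
  obtain ⟨⟨c, t⟩, hc⟩ := IsLocalization.surj x.asIdeal.primeCompl a
  dsimp only at hc
  have hc0 : c ≠ 0 := by
    rintro rfl
    rw [map_zero] at hc
    exact ha (((IsLocalization.map_units _ t).mul_left_eq_zero).1 hc)
  obtain ⟨d, hd⟩ := hR.mul_inv_cancel hc0
  have hcu : IsUnit (algebraMap R ((Spec R).presheaf.stalk x) c) :=
    (IsUnit.of_mul_eq_one d hd).map _
  rw [← hc] at hcu
  exact isUnit_of_mul_isUnit_left hcu

theorem isHyperfield_stalk_Spec (x : Spec (CommRingCat.of k)) :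
    IsHyperfield (ringToHyperring.obj ((Spec (CommRingCat.of k)).presheaf.stalk x)) where
  exists_pair_ne := exists_pair_ne ((Spec (CommRingCat.of k)).presheaf.stalk x)
  exists_mul_eq_one := by
    intro (a : (Spec (CommRingCat.of k)).presheaf.stalk x) ha
    exact (isUnit_stalk_Spec (CommRingCat.of k) (Field.toIsField k) x a ha).exists_right_inv

theorem isLocal_structureMapPsh (x : (hyperfieldSpec H).carrier)
    (m : Set ((hyperfieldSpec H).stalk x)) (hm : IsMaximalIdeal m) :
    IsMaximalIdeal (LocallyHyperringedSpace.stalkMap (structureMapPsh φ) x ⁻¹' m) := by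
  have h1 : IsHyperfield ((hyperfieldSpec H).stalk x) :=
    isHyperfield_of_iso (S := HyperringCat.of H) (hyperfieldSpecStalkIso H x)
  have h2 := isHyperfield_stalk_Spec (k := k) ((structureMapPsh φ).base x)
  have h3 := isHyperfield_of_iso (schemeStalkIso _ ((structureMapPsh φ).base x))
  refine isMaximalIdeal_iff_of_isHyperfield.2 (IsIdeal.eq_zero_of_isHyperfield
    (hm.isIdeal.preimage (HyperringCat.Hom.hom _)) fun h => ?_)
  refine hm.ne_univ (hm.isIdeal.eq_univ_of_one_mem ?_)
  have h4 := map_one (HyperringCat.Hom.hom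
    (LocallyHyperringedSpace.stalkMap (structureMapPsh φ) x))
  rw [← h4]
  exact Set.eq_univ_iff_forall.1 h 1

/-- The morphism `Spec H ⟶ Spec k` of locally hyperringed spaces attached to a homomorphism
`φ : k → H`. -/
noncomputable def structureMap :
    hyperfieldSpec H ⟶ schemeToLHS.obj (Spec (CommRingCat.of k)) :=
  ⟨structureMapPsh φ, isLocal_structureMapPsh φ⟩

end StructureMap

/-! ### Rational points over a hyperfield and the fine Zariski topology -/

section Points

variable {k : Type u} [Field k] {H : Type u} [Hyperring H] [IsHyperfield H]
  (φ : ringToHyperring.obj (CommRingCat.of k) ⟶ HyperringCat.of H)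

/-- The set `X(H) = Hom_k(Spec H, X)` of the morphisms of locally hyperringed spaces over `k`. -/
def HPoints (X : Over (Spec (CommRingCat.of k))) : Type u :=
  {p : hyperfieldSpec H ⟶ schemeToLHS.obj X.left // p ≫ schemeToLHS.map X.hom = structureMap φ}

namespace HPoints

variable {φ}

/-- The image in `X` of the point of `Spec H`. -/
noncomputable def pt {X : Over (Spec (CommRingCat.of k))} (p : HPoints φ X) : X.left :=
  p.1.toPsh.base (hyperfieldSpecPt H)

/-- The value in `H` at `p ∈ X(H)` of a section defined on a neighbourhood of the image of `p`:
the pullback of the section to `Spec H`, evaluated at the point of `Spec H`. -/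
noncomputable def value {X : Over (Spec (CommRingCat.of k))} (p : HPoints φ X) (U : X.left.Opens)
    (hU : p.pt ∈ U) (s : Γ(X.left, U)) : H :=
  (show {y : HyperSpec H // y ∈ (Opens.map p.1.toPsh.base).obj U} → H from
    HyperringCat.Hom.hom (p.1.toPsh.c.app (op U)) s) ⟨hyperfieldSpecPt H, hU⟩

/-- The map `X(H) → Y(H)` induced by a morphism `X ⟶ Y` over `k`. -/
noncomputable def map {X Y : Over (Spec (CommRingCat.of k))} (f : X ⟶ Y) (p : HPoints φ X) : HPoints φ Y :=
  ⟨p.1 ≫ schemeToLHS.map f.left, by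
    rw [Category.assoc, ← schemeToLHS.map_comp, Over.w f, p.2]⟩

theorem map_id {X : Over (Spec (CommRingCat.of k))} (p : HPoints φ X) : map (𝟙 X) p = p :=
  Subtype.ext (by
    change p.1 ≫ schemeToLHS.map (𝟙 X.left) = p.1
    rw [schemeToLHS.map_id]
    exact Category.comp_id _)

theorem map_comp {X Y Z : Over (Spec (CommRingCat.of k))} (f : X ⟶ Y) (g : Y ⟶ Z)
    (p : HPoints φ X) : map (f ≫ g) p = map g (map f p) :=
  Subtype.ext (by
    change p.1 ≫ schemeToLHS.map (f.left ≫ g.left) = (p.1 ≫ schemeToLHS.map f.left) ≫ _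
    rw [schemeToLHS.map_comp, Category.assoc])

variable [TopologicalSpace H]

/-- The affine topology on `Y(H) = Hom_k(Γ(Y), H) ⊆ ∏_{a ∈ Γ(Y)} H` for affine `Y`: the coarsest
topology for which the evaluations at the global sections of `Y` are continuous. -/
@[reducible]
noncomputable def affineTopology (Y : Over (Spec (CommRingCat.of k))) : TopologicalSpace (HPoints φ Y) :=
  ⨅ a : Γ(Y.left, ⊤), TopologicalSpace.induced (fun p => p.value ⊤ trivial a) inferInstance

/-- The fine Zariski topology on `X(H)`: the finest topology for which all the maps
`Y(H) → X(H)` induced by morphisms `Y ⟶ X` over `k` from affine `k`-schemes `Y` are continuous,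
where `Y(H)` has the affine topology. -/
noncomputable instance fineZariskiTopology (X : Over (Spec (CommRingCat.of k))) :
    TopologicalSpace (HPoints φ X) :=
  ⨆ (Y : Over (Spec (CommRingCat.of k))) (_ : IsAffine Y.left) (f : Y ⟶ X),
    TopologicalSpace.coinduced (map f) (affineTopology Y)

theorem continuous_map {X Y : Over (Spec (CommRingCat.of k))} (f : X ⟶ Y) :
    Continuous (map f : HPoints φ X → HPoints φ Y) := by
  refine continuous_iSup_dom.2 fun Z => continuous_iSup_dom.2 fun hZ => continuous_iSup_dom.2 fun g =>
    continuous_coinduced_dom.2 ?_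
  have h : (map f ∘ map g : HPoints φ Z → HPoints φ Y) = map (g ≫ f) :=
    funext fun p => (map_comp g f p).symm
  rw [h]
  exact continuous_iff_coinduced_le.2
    (le_iSup_of_le Z (le_iSup_of_le hZ (le_iSup_of_le (g ≫ f) le_rfl)))

end HPoints

end Points

/-! ### Schemes of finite type and the Berkovich analytification -/

/-- The property of `k`-schemes of being of finite type. -/
def finiteType (k : Type u) [Field k] : ObjectProperty (Over (Spec (CommRingCat.of k))) :=
  fun X => LocallyOfFiniteType X.hom ∧ QuasiCompact X.hom

/-- The category of schemes of finite type over `k`. -/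
abbrev FiniteTypeSchemes (k : Type u) [Field k] : Type (u + 1) :=
  (finiteType k).FullSubcategory

/-- The functor `X ↦ X(H)` from schemes of finite type over `k` to topological spaces, where
`X(H)` has the fine Zariski topology. -/
noncomputable def pointsFunctor {k : Type u} [Field k] {H : Type u} [Hyperring H] [IsHyperfield H]
    [TopologicalSpace H] (φ : ringToHyperring.obj (CommRingCat.of k) ⟶ HyperringCat.of H) :
    FiniteTypeSchemes k ⥤ TopCat.{u} where
  obj X := TopCat.of (HPoints φ X.obj)
  map f := TopCat.ofHom ⟨HPoints.map f.hom, HPoints.continuous_map f.hom⟩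
  map_id X := by
    ext p
    exact HPoints.map_id p
  map_comp f g := by
    ext p
    exact HPoints.map_comp f.hom g.hom p

section Berkovich

variable {k : Type u} [NormedField k]

/-- The structure homomorphism `k → κ(x)` of the residue field at a point of a `k`-scheme. -/
noncomputable def toResidueField (X : Over (Spec (CommRingCat.of k))) (x : X.left) :
    CommRingCat.of k ⟶ X.left.residueField x :=
  (Scheme.ΓSpecIso (CommRingCat.of k)).inv ≫ X.hom.appTop ≫ X.left.Γevaluation x

/-- The points of the Berkovich analytification of a `k`-scheme `X`: pairs of a point `x` of `X`
and an absolute value on the residue field at `x` that extends the one of `k`. -/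
structure Analytification (X : Over (Spec (CommRingCat.of k))) : Type u where
  /-- The underlying point of the scheme. -/
  pt : X.left
  /-- The absolute value on its residue field. -/
  abv : AbsoluteValue (X.left.residueField pt) ℝ
  abv_toResidueField : ∀ c : k, abv ((toResidueField X pt).hom c) = ‖c‖

namespace Analytification

/-- The absolute value `|s(x)|` at a point of the analytification of a section defined on a
neighbourhood of its underlying point. -/
noncomputable def value {X : Over (Spec (CommRingCat.of k))} (x : Analytification X)
    (U : X.left.Opens) (hU : x.pt ∈ U) (s : Γ(X.left, U)) : ℝ :=
  x.abv ((X.left.evaluation U x.pt hU).hom s)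

/-- The topology of the analytification: the coarsest one such that `X^an → X` is continuous and
such that `x ↦ |s(x)|` is continuous on the preimage of `U` for every section `s` over an open
set `U`. -/
instance (X : Over (Spec (CommRingCat.of k))) : TopologicalSpace (Analytification X) :=
  TopologicalSpace.generateFrom
    {W | ∃ (U : X.left.Opens) (s : Γ(X.left, U)) (V : Set ℝ), IsOpen V ∧
      W = {x | ∃ hU : x.pt ∈ U, x.value U hU s ∈ V}}

/-- The map `X^an → Y^an` induced by a morphism `X ⟶ Y` over `k`. -/
noncomputable def map {X Y : Over (Spec (CommRingCat.of k))} (f : X ⟶ Y) (x : Analytification X) :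
    Analytification Y where
  pt := f.left x.pt
  abv := x.abv.comp (f := (f.left.residueFieldMap x.pt).hom) (RingHom.injective _)
  abv_toResidueField c := by
    rw [← x.abv_toResidueField c]
    refine congrArg x.abv ?_
    have h : toResidueField Y (f.left x.pt) ≫ f.left.residueFieldMap x.pt =
        toResidueField X x.pt := by
      have hw : X.hom.appTop = Y.hom.appTop ≫ f.left.appTop := by
        rw [← Scheme.Hom.comp_appTop, Over.w]
      unfold toResidueField
      rw [Category.assoc, Category.assoc, Scheme.Γevaluation_naturality, hw, Category.assoc]
    exact congrArg (fun g => g.hom c) h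

theorem value_map {X Y : Over (Spec (CommRingCat.of k))} (f : X ⟶ Y) (x : Analytification X)
    (U : Y.left.Opens) (hU : (map f x).pt ∈ U) (s : Γ(Y.left, U)) :
    (map f x).value U hU s = x.value (f.left ⁻¹ᵁ U) hU (f.left.app U s) :=
  congrArg x.abv (Scheme.evaluation_naturality_apply f.left x.pt hU s)

theorem continuous_map {X Y : Over (Spec (CommRingCat.of k))} (f : X ⟶ Y) :
    Continuous (map f) := by
  refine continuous_generateFrom_iff.2 ?_
  rintro _ ⟨U, s, V, hV, rfl⟩
  refine TopologicalSpace.isOpen_generateFrom_of_mem ⟨f.left ⁻¹ᵁ U, f.left.app U s, V, hV, ?_⟩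
  ext x
  exact exists_congr fun hU => by rw [value_map]

theorem ext' {X : Over (Spec (CommRingCat.of k))} {x y : Analytification X} (h : x.pt = y.pt)
    (h' : ∀ a, x.abv a = y.abv ((X.left.residueFieldCongr h).hom.hom a)) : x = y := by
  obtain ⟨x, v, hv⟩ := x
  obtain ⟨y, w, hw⟩ := y
  dsimp only at h
  subst h
  have : v = w := AbsoluteValue.ext fun a => h' a
  subst this
  rfl

theorem map_id {X : Over (Spec (CommRingCat.of k))} (x : Analytification X) :
    map (𝟙 X) x = x := by
  refine ext' rfl fun a => congrArg x.abv ?_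
  exact congrArg (fun g => g.hom a) (Scheme.residueFieldMap_id x.pt)

theorem map_comp {X Y Z : Over (Spec (CommRingCat.of k))} (f : X ⟶ Y) (g : Y ⟶ Z)
    (x : Analytification X) : map (f ≫ g) x = map g (map f x) := by
  refine ext' rfl fun a => congrArg x.abv ?_
  exact congrArg (fun g => g.hom a) (Scheme.residueFieldMap_comp f.left g.left x.pt)

end Analytification

/-- The functor `X ↦ |X^an|` from schemes of finite type over `k` to topological spaces. -/
noncomputable def analytificationFunctor (k : Type u) [NormedField k] :
    FiniteTypeSchemes k ⥤ TopCat.{u} where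
  obj X := TopCat.of (Analytification X.obj)
  map f := TopCat.ofHom ⟨Analytification.map f.hom, Analytification.continuous_map f.hom⟩
  map_id X := by
    ext x
    exact Analytification.map_id x
  map_comp f g := by
    ext x
    exact Analytification.map_comp f.hom g.hom x

end Berkovich

end HyperGeom

/-! A morphism from the one-point space `Spec H` of a hyperfield to a scheme `Y` amounts to a point
`y` together with a hyperring homomorphism from the local ring at `y` to `H`. Locality says that
this homomorphism vanishes exactly on the maximal ideal (`isLocal_iff_stalkEval`). Vanishing on the
kernel is enough to descend along a surjection of rings, since `0` is a single-valued identity for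
hyperaddition (`exists_desc_of_surjective`). So the morphism is the same as `y` with a homomorphism
`κ(y) → H` (`residuePoint`, `exists_residueField_hom`).

For `H = 𝕋`, a homomorphism from a field is the logarithm of a non-Archimedean absolute value:
membership in a hypersum of `𝕋` means that each of three elements is at most the maximum of the
other two, which is the ultrametric inequality for `a + b` and its rearrangements (`logAbv`,
`abvOfHom`). Being a morphism over `k` means extending the absolute value of `k`
(`residuePoint_comp_eq_structureMap_iff`), and every extension is automatically non-Archimedean.
This gives the natural bijection `tropEquiv`.

For the topology, `log` identifies `[0, ∞)` with `𝕋`, so the affine topology is the topology of the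
functions `|a|` for global sections `a`. On an affine scheme these already determine the Berkovich
topology, because locally a section is a fraction `a / f ^ n`
(`Analytification.continuous_of_isAffine`). The map to `𝕋`-points is continuous because this can be
tested over affine open subschemes, which are among the test objects of the fine Zariski topology
(`continuousOn_tropPoint`). Its inverse is continuous because the fine topology is tested on affine
schemes mapping to `X`, where naturality reduces to the affine statement
(`continuous_tropEquiv_symm`). Such test schemes are arbitrary affine `k`-schemes, so the comparison
is built for all `k`-schemes and specialized at the end. -/

namespace HyperGeom

/-! ### The logarithm as a homeomorphism -/

namespace Trop

theorem mem_hadd {a b c : Trop.{u}} :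
    c ∈ Hyperring.hadd a b ↔ c.val ≤ max a.val b.val ∧ a.val ≤ max b.val c.val ∧
      b.val ≤ max a.val c.val :=
  mem_haddBot

/-- Together with surjectivity this makes `log` an order isomorphism on `[0, ∞)`; its continuity in
both directions then follows from order topologies alone, with no separate analysis at `-∞`. -/
theorem strictMono_log : StrictMono fun r : NNReal => (log.{u} r).val := by
  intro r s h
  have hs : s ≠ 0 := (pos_of_gt h).ne'
  by_cases hr : r = 0
  · simp [log, hr, hs, WithBot.bot_lt_coe]
  · simp only [log, NNReal.coe_eq_zero, hr, hs, if_false, WithBot.coe_lt_coe]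
    exact Real.log_lt_log (NNReal.coe_pos.2 (pos_iff_ne_zero.2 hr)) h

theorem surjective_log : Function.Surjective fun r : NNReal => (log.{u} r).val := by
  intro a
  induction a using WithBot.recBotCoe with
  | bot => exact ⟨0, by simp [log]⟩
  | coe r => exact ⟨(Real.exp r).toNNReal, by
      simp [log, Real.coe_toNNReal _ (Real.exp_pos r).le, (Real.exp_pos r).ne']⟩

/-- The logarithm as an isomorphism of ordered sets `[0, ∞) ≃ ℝ ∪ {-∞}`. -/
noncomputable def logOrderIso : NNReal ≃o WithBot ℝ :=
  StrictMono.orderIsoOfSurjective _ strictMono_log.{u} surjective_log.{u}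

theorem logOrderIso_apply (r : NNReal) : logOrderIso.{u} r = (log.{u} r).val :=
  rfl

/-- `Real.log` is even, so `log` on all of `ℝ` factors through `[0, ∞)`. This is also why `exp (log
r)` is `|r|`, and why nonnegativity is assumed when `log` is cancelled. -/
theorem log_nnnorm (r : ℝ) : log.{u} ‖r‖₊ = log r := by
  rw [coe_nnnorm, Real.norm_eq_abs]
  simp only [log, abs_eq_zero, Real.log_abs]

/-- The exponential `ℝ ∪ {-∞} → [0, ∞)`, with `exp (-∞) = 0`. -/
noncomputable def exp (a : Trop.{u}) : ℝ :=
  logOrderIso.{u}.symm a.val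

theorem log_exp (a : Trop.{u}) : log (exp a) = a :=
  Trop.ext (logOrderIso.{u}.apply_symm_apply a.val)

theorem exp_log (r : ℝ) : exp (log.{u} r) = |r| := by
  rw [← log_nnnorm, exp, ← logOrderIso_apply, OrderIso.symm_apply_apply, coe_nnnorm,
    Real.norm_eq_abs]

theorem exp_nonneg (a : Trop.{u}) : 0 ≤ exp a :=
  NNReal.coe_nonneg _

theorem exp_le_exp {a b : Trop.{u}} : exp a ≤ exp b ↔ a.val ≤ b.val :=
  NNReal.coe_le_coe.trans (OrderIso.le_iff_le _)

theorem exp_mul (a b : Trop.{u}) : exp (a * b) = exp a * exp b := by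
  have h : a * b = log (exp a * exp b) := by rw [log_mul, log_exp, log_exp]
  rw [h, exp_log, abs_of_nonneg (mul_nonneg (exp_nonneg a) (exp_nonneg b))]

theorem exp_zero : exp (0 : Trop.{u}) = 0 := by
  rw [← log_zero, exp_log, abs_zero]

theorem exp_eq_zero {a : Trop.{u}} : exp a = 0 ↔ a = 0 := by
  refine ⟨fun h => ?_, fun h => h ▸ exp_zero⟩
  rw [← log_exp a, h, log_zero]

theorem log_inj {r s : ℝ} (hr : 0 ≤ r) (hs : 0 ≤ s) (h : log.{u} r = log.{u} s) : r = s := by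
  simpa only [exp_log, abs_of_nonneg, hr, hs] using congrArg exp h

theorem exp_le_max_of_mem_hadd {a b c : Trop.{u}} (h : c ∈ Hyperring.hadd a b) :
    exp c ≤ max (exp a) (exp b) := by
  simpa only [le_max_iff, exp_le_exp] using (mem_hadd.1 h).1

theorem continuous_log : Continuous log.{u} := by
  -- The topology of `Trop` is induced from this order topology; as a local instance it makes the
  -- order isomorphism a homeomorphism.
  let _ : TopologicalSpace (WithBot ℝ) := Preorder.topology (WithBot ℝ)
  have _ : OrderTopology (WithBot ℝ) := ⟨rfl⟩
  refine continuous_induced_rng.2 ?_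
  have h : val ∘ log.{u} = logOrderIso.{u} ∘ fun r : ℝ => ‖r‖₊ :=
    funext fun r => (congrArg val (log_nnnorm.{u} r)).symm
  rw [h]
  exact (logOrderIso.{u}.toHomeomorph.continuous).comp continuous_nnnorm

theorem continuous_exp : Continuous exp.{u} := by
  let _ : TopologicalSpace (WithBot ℝ) := Preorder.topology (WithBot ℝ)
  have _ : OrderTopology (WithBot ℝ) := ⟨rfl⟩
  exact NNReal.continuous_coe.comp
    (logOrderIso.{u}.toHomeomorph.symm.continuous.comp continuous_induced_dom)

end Trop

/-! ### Absolute values and homomorphisms to the tropical hyperfield -/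

/-- An absolute value that is at most one on the natural numbers is non-Archimedean. -/
theorem isNonarchimedean_of_natCast_le_one {K : Type u} [Field K] (v : AbsoluteValue K ℝ)
    (h : ∀ n : ℕ, v n ≤ 1) : IsNonarchimedean v := by
  -- With `v` as the norm of `K`, the ultrametric criterion for normed fields applies.
  let _ : NormedField K := v.toNormedField
  have _ : IsUltrametricDist K :=
    IsUltrametricDist.isUltrametricDist_of_forall_norm_natCast_le_one h
  exact fun x y => IsUltrametricDist.norm_add_le_max x y

/-- The natural numbers of `K` are images of those of `k`, where the ultrametric inequality already
bounds them by one. -/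
theorem isNonarchimedean_of_extends {k K : Type u} [NormedField k] [IsUltrametricDist k] [Field K]
    (v : AbsoluteValue K ℝ) (f : k →+* K) (h : ∀ c, v (f c) = ‖c‖) : IsNonarchimedean v :=
  isNonarchimedean_of_natCast_le_one v fun n => by
    rw [← map_natCast f, h]
    exact IsUltrametricDist.norm_natCast_le_one k n

/-- The logarithm of a non-Archimedean absolute value, as a homomorphism of hyperrings. -/
noncomputable def logAbv {K : CommRingCat.{u}} (v : AbsoluteValue K ℝ) [Nontrivial K]
    [NoZeroDivisors K] (hv : IsNonarchimedean v) :
    ringToHyperring.obj K ⟶ HyperringCat.of Trop.{u} :=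
  ⟨{ toFun := fun c : K => Trop.log (v c)
     map_zero' := (congrArg Trop.log (map_zero v)).trans Trop.log_zero
     map_one' := (congrArg Trop.log (map_one v)).trans Trop.log_one
     map_mul' := fun a b : K => (congrArg Trop.log (map_mul v a b)).trans (Trop.log_mul _ _)
     map_hadd' := by
      rintro (a : K) (b : K) _ rfl
      have key : ∀ x y : K, (Trop.log.{u} (v (x + y))).val ≤
          max (Trop.log.{u} (v x)).val (Trop.log.{u} (v y)).val := by
        intro x y
        rcases le_max_iff.1 (hv x y) with h | h
        · exact le_max_of_le_left (Trop.log_le_log (v.nonneg _) h)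
        · exact le_max_of_le_right (Trop.log_le_log (v.nonneg _) h)
      -- The two remaining inequalities are the ultrametric inequality for `a = -b + (a + b)` and `b
      -- = -a + (a + b)`.
      refine Trop.mem_hadd.2 ⟨key a b, ?_, ?_⟩
      · have := key (-b) (a + b)
        rwa [neg_add_cancel_comm_assoc, v.map_neg] at this
      · have := key (-a) (a + b)
        rwa [neg_add_cancel_left, v.map_neg] at this }⟩

/-! ### Morphisms from the spectrum of a hyperfield to a scheme -/

section HyperfieldPoints

variable {H : Type u} [Hyperring H] [IsHyperfield H] {Y : Scheme.{u}}

/-- Evaluation of the sections of the structure sheaf of `Spec H` at a point. -/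
def hyperSpecEval (x : TopCat.of (HyperSpec H)) (U : Opens (TopCat.of (HyperSpec H)))
    (hU : x ∈ U) : (hyperfieldSpec H).presheaf.obj (op U) ⟶ HyperringCat.of H :=
  ⟨{ toFun := fun g : U → H => g ⟨x, hU⟩
     map_zero' := rfl
     map_one' := rfl
     map_mul' := fun _ _ => rfl
     map_hadd' := fun _ _ _ h => h ⟨x, hU⟩ }⟩

theorem germ_hyperfieldSpecStalkIso_hom (x : TopCat.of (HyperSpec H)) (U : OpenNhds x) :
    (hyperfieldSpec H).germ x U ≫ (hyperfieldSpecStalkIso H x).hom =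
      hyperSpecEval x U.1 U.2 :=
  (colimit.isColimit (stalkDiagram (hyperSpecPresheaf H)
    x)).comp_coconePointUniqueUpToIso_hom (hyperSpecStalkIsColimit H x) (op U)

/-- The homomorphism from the stalk of a scheme at the image of a point of `Spec H` to `H`. -/
noncomputable def stalkEval
    (f : (hyperfieldSpec H).toPresheafedSpace ⟶ (schemeToLHSObj Y).toPresheafedSpace)
    (x : (hyperfieldSpec H).carrier) :
    ringToHyperring.obj (Y.presheaf.stalk (f.base x)) ⟶ HyperringCat.of H :=
  (schemeStalkIso Y (f.base x)).inv ≫ LocallyHyperringedSpace.stalkMap f x ≫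
    (hyperfieldSpecStalkIso H x).hom

/-- The map on stalks comes abstractly from a colimit. This computes it on germs, which exhaust the
stalk, as pullback of a section followed by evaluation at the point. -/
theorem germ_stalkEval
    (f : (hyperfieldSpec H).toPresheafedSpace ⟶ (schemeToLHSObj Y).toPresheafedSpace)
    (x : (hyperfieldSpec H).carrier) (U : Y.Opens) (hU : f.base x ∈ U) :
    ringToHyperring.map (Y.presheaf.germ U (f.base x) hU) ≫ stalkEval f x =
      f.c.app (op U) ≫ hyperSpecEval x ((Opens.map f.base).obj U) hU := by
  have h1 := germ_schemeStalkIso_hom Y (f.base x) ⟨U, hU⟩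
  have h2 := LocallyHyperringedSpace.germ_stalkMap (Y := schemeToLHSObj Y) f x ⟨U, hU⟩
  have h3 := germ_hyperfieldSpecStalkIso_hom x ((OpenNhds.map f.base x).obj ⟨U, hU⟩)
  have h4 : ringToHyperring.map (Y.presheaf.germ U (f.base x) hU) ≫
      (schemeStalkIso Y (f.base x)).inv = (schemeToLHSObj Y).germ (f.base x) ⟨U, hU⟩ :=
    ((Iso.eq_comp_inv _).2 h1).symm
  refine (Category.assoc _ _ _).symm.trans ?_
  refine (congrArg (· ≫ LocallyHyperringedSpace.stalkMap f x ≫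
    (hyperfieldSpecStalkIso H x).hom) h4).trans ?_
  refine (Category.assoc _ _ _).symm.trans ?_
  refine (congrArg (· ≫ (hyperfieldSpecStalkIso H x).hom) h2).trans ?_
  refine (Category.assoc _ _ _).trans ?_
  exact congrArg (f.c.app (op U) ≫ ·) h3

/-- A map from `Spec H` to a scheme is local if and only if the induced homomorphism from the stalk
to `H` vanishes exactly on the maximal ideal. -/
theorem isLocal_iff_stalkEval
    (f : (hyperfieldSpec H).toPresheafedSpace ⟶ (schemeToLHSObj Y).toPresheafedSpace)
    (x : (hyperfieldSpec H).carrier) :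
    (∀ m : Set ((hyperfieldSpec H).stalk x), IsMaximalIdeal m →
      IsMaximalIdeal (LocallyHyperringedSpace.stalkMap (Y := schemeToLHSObj Y) f x ⁻¹' m)) ↔
    ∀ a : Y.presheaf.stalk (f.base x), HyperringCat.Hom.hom (stalkEval f x) a = 0 ↔ ¬ IsUnit a := by
  have hloc : IsLocalRing (Y.presheaf.stalk (f.base x)) :=
    Y.toLocallyRingedSpace.isLocalRing (f.base x)
  have hset (a : (schemeToLHSObj Y).stalk (f.base x)) :
      HyperringCat.Hom.hom (stalkEval f x) ((schemeStalkIso Y (f.base x)).hom a) =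
        (hyperfieldSpecStalkIso H x).hom (LocallyHyperringedSpace.stalkMap f x a) := by
    have h : (schemeStalkIso Y (f.base x)).hom ≫ stalkEval f x =
        LocallyHyperringedSpace.stalkMap f x ≫ (hyperfieldSpecStalkIso H x).hom :=
      Iso.hom_inv_id_assoc _ _
    exact congrArg (fun g => HyperringCat.Hom.hom g a) h
  -- The stalk of `Spec H` is the hyperfield `H`, so its only maximal ideal corresponds to `{0}`;
  -- locality has to be tested on this one ideal.
  have h0 : IsMaximalIdeal ((hyperfieldSpecStalkIso H x).hom ⁻¹' ({0} : Set H)) :=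
    isMaximalIdeal_preimage_iso _ (isMaximalIdeal_iff_of_isHyperfield.2 rfl)
  have hpre : LocallyHyperringedSpace.stalkMap f x ⁻¹'
      ((hyperfieldSpecStalkIso H x).hom ⁻¹' ({0} : Set H)) =
      (schemeStalkIso Y (f.base x)).hom ⁻¹'
        (HyperringCat.Hom.hom (stalkEval f x) ⁻¹' ({0} : Set H)) := by
    ext a
    exact iff_of_eq (congrArg (· ∈ ({0} : Set H)) (hset a).symm)
  constructor
  · intro h a
    have h1 := h _ h0
    rw [hpre] at h1
    have h2 := isMaximalIdeal_preimage_iso (schemeStalkIso Y (f.base x)).symm h1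
    obtain ⟨J, hJ, hJ'⟩ := (isMaximalIdeal_ring_iff _ _).1 h2
    rw [IsLocalRing.eq_maximalIdeal hJ] at hJ'
    have h3 := Set.ext_iff.1 hJ' a
    rw [SetLike.mem_coe, IsLocalRing.mem_maximalIdeal, mem_nonunits_iff] at h3
    have h4 : (schemeStalkIso Y (f.base x)).hom ((schemeStalkIso Y (f.base x)).inv a) = a :=
      congrArg (fun g => HyperringCat.Hom.hom g a) (schemeStalkIso Y (f.base x)).inv_hom_id
    exact (iff_of_eq (congrArg (fun b => HyperringCat.Hom.hom (stalkEval f x) b = 0)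
      h4.symm)).trans h3.symm
  · intro h m hm
    obtain ⟨m', -, hu⟩ := (hyperfieldSpec H).existsUnique_maximal x
    rw [(hu m hm).trans (hu _ h0).symm, hpre]
    refine isMaximalIdeal_preimage_iso _ ((isMaximalIdeal_ring_iff _ _).2
      ⟨_, IsLocalRing.maximalIdeal.isMaximal _, ?_⟩)
    ext a
    exact (h a).symm

/-- The map `Spec H → Y` given by a point of `Y` and a homomorphism from its residue field to `H`,
on the underlying spaces with presheaves. -/
noncomputable def residuePointPsh (y : Y) (ψ : ringToHyperring.obj (Y.residueField y) ⟶
    HyperringCat.of H) :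
    (hyperfieldSpec H).toPresheafedSpace ⟶ (schemeToLHSObj Y).toPresheafedSpace where
  base := TopCat.ofHom ⟨fun _ => y, continuous_const⟩
  c :=
    -- The base map is constant, so a point `x` of the preimage of `U` carries a proof `x.2` that `y
    -- ∈ U`. If `y ∉ U`, the preimage is empty and there is nothing to evaluate.
    { app := fun U => ⟨
        { toFun := fun s x => HyperringCat.Hom.hom
            (ringToHyperring.map (Y.evaluation U.unop y x.2) ≫ ψ) s
          map_zero' := funext fun x => map_zero (HyperringCat.Hom.hom
            (ringToHyperring.map (Y.evaluation U.unop y x.2) ≫ ψ))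
          map_one' := funext fun x => map_one (HyperringCat.Hom.hom
            (ringToHyperring.map (Y.evaluation U.unop y x.2) ≫ ψ))
          map_mul' := fun a b => funext fun x => map_mul (HyperringCat.Hom.hom
            (ringToHyperring.map (Y.evaluation U.unop y x.2) ≫ ψ)) a b
          map_hadd' := fun _ _ _ h x => HyperringHom.map_hadd (HyperringCat.Hom.hom
            (ringToHyperring.map (Y.evaluation U.unop y x.2) ≫ ψ)) h }⟩
      naturality := by
        intro U V i
        apply ConcreteCategory.hom_ext
        intro s
        funext x
        refine congrArg (HyperringCat.Hom.hom ψ) ?_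
        exact congrArg (Y.residue y).hom (Y.presheaf.germ_res_apply i.unop y x.2 s) }

/-- Evaluation at `y` is the germ followed by the residue map, so both sides agree on germs.
Locality of `residuePoint` then reads off from the kernel of the residue map. -/
theorem stalkEval_residuePointPsh (y : Y) (ψ : ringToHyperring.obj (Y.residueField y) ⟶
    HyperringCat.of H) (x : (hyperfieldSpec H).carrier) :
    stalkEval (residuePointPsh y ψ) x = ringToHyperring.map (Y.residue y) ≫ ψ := by
  apply ConcreteCategory.hom_ext
  intro (a : Y.presheaf.stalk y)
  obtain ⟨U, hU, s, rfl⟩ := Y.presheaf.exists_germ_eq a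
  have h := germ_stalkEval (residuePointPsh y ψ) x U hU
  exact congrArg (fun g => HyperringCat.Hom.hom g s) h

/-- A nonzero element of a field is a unit, and a unit cannot map to zero because `1 ≠ 0` in `H`. -/
theorem hom_eq_zero_iff {K : CommRingCat.{u}} (hK : IsField K)
    (ψ : ringToHyperring.obj K ⟶ HyperringCat.of H) (a : K) :
    HyperringCat.Hom.hom ψ a = 0 ↔ a = 0 := by
  refine ⟨fun h => ?_, ?_⟩
  · by_contra ha
    obtain ⟨b, hb⟩ := hK.mul_inv_cancel ha
    have h1 : HyperringCat.Hom.hom ψ (a * b : K) = HyperringCat.Hom.hom ψ a *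
      HyperringCat.Hom.hom ψ b := map_mul (HyperringCat.Hom.hom ψ) a b
    rw [hb, h, zero_mul] at h1
    exact one_ne_zero ((map_one (HyperringCat.Hom.hom ψ)).symm.trans h1)
  · rintro rfl
    exact map_zero (HyperringCat.Hom.hom ψ)

/-- The morphism `Spec H → Y` given by a point of `Y` and a homomorphism from its residue field
to `H`. -/
noncomputable def residuePoint (y : Y) (ψ : ringToHyperring.obj (Y.residueField y) ⟶
    HyperringCat.of H) : hyperfieldSpec H ⟶ schemeToLHS.obj Y :=
  ⟨residuePointPsh y ψ, fun x => (isLocal_iff_stalkEval _ x).2 fun a => by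
    rw [stalkEval_residuePointPsh]
    exact (hom_eq_zero_iff (Field.toIsField (Y.residueField y)) ψ _).trans
      ((IsLocalRing.residue_eq_zero_iff (R := Y.presheaf.stalk y) a).trans
        (IsLocalRing.mem_maximalIdeal (R := Y.presheaf.stalk y) a))⟩

/-- Two morphisms from `Spec H` to a scheme agree if they have the same image and the same values
on sections. -/
theorem hyperfieldSpec_hom_ext {f g : hyperfieldSpec H ⟶ schemeToLHS.obj Y}
    (h : f.toPsh.base (hyperfieldSpecPt H) = g.toPsh.base (hyperfieldSpecPt H))
    (h' : ∀ (U : Y.Opens) (hf : f.toPsh.base (hyperfieldSpecPt H) ∈ U)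
      (hg : g.toPsh.base (hyperfieldSpecPt H) ∈ U) (s : Γ(Y, U)),
      HyperringCat.Hom.hom (f.toPsh.c.app (op U) ≫ hyperSpecEval (hyperfieldSpecPt H)
        ((Opens.map f.toPsh.base).obj U) hf) s =
      HyperringCat.Hom.hom (g.toPsh.c.app (op U) ≫ hyperSpecEval (hyperfieldSpecPt H)
        ((Opens.map g.toPsh.base).obj U) hg) s) : f = g := by
  -- The sheaf maps have types depending on the base maps, so the base maps are identified first.
  obtain ⟨⟨fb, fc⟩, hf⟩ := f
  obtain ⟨⟨gb, gc⟩, hg⟩ := g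
  have hb : fb = gb := by
    apply ConcreteCategory.hom_ext
    intro x
    obtain rfl : x = hyperfieldSpecPt H := Subsingleton.elim (α := HyperSpec H) _ _
    exact h
  subst hb
  have hc : fc = gc := by
    apply NatTrans.ext
    funext U
    apply ConcreteCategory.hom_ext
    intro s
    refine funext (α := {y : HyperSpec H // y ∈ (Opens.map fb).obj U.unop}) ?_
    rintro ⟨x, hx⟩
    obtain rfl : x = hyperfieldSpecPt H := Subsingleton.elim (α := HyperSpec H) _ _
    exact h' U.unop hx hx s
  subst hc
  rfl

end HyperfieldPoints

/-- A homomorphism from a ring to a hyperring that vanishes on the kernel of a surjective ring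
homomorphism factors through it. -/
theorem exists_desc_of_surjective {A B : CommRingCat.{u}} {H : Type u} [Hyperring H] (q : A ⟶ B)
    (hq : Function.Surjective q.hom) (ψ : ringToHyperring.obj A ⟶ HyperringCat.of H)
    (h : ∀ a : A, q.hom a = 0 → HyperringCat.Hom.hom ψ a = 0) :
    ∃ ψ' : ringToHyperring.obj B ⟶ HyperringCat.of H, ringToHyperring.map q ≫ ψ' = ψ := by
  have key : ∀ a b : A, q.hom a = q.hom b →
      HyperringCat.Hom.hom ψ a = HyperringCat.Hom.hom ψ b := by
    intro a b hab
    have h1 : HyperringCat.Hom.hom ψ (a - b : A) = 0 :=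
      h _ (by rw [map_sub, hab, sub_self])
    -- From `a ∈ (a - b) ⊞ b` one gets `ψ a ∈ 0 ⊞ ψ b = {ψ b}`: the multivalued sum collapses
    -- because one summand is zero.
    have h2 := (HyperringCat.Hom.hom ψ).map_hadd
      (show a ∈ ({(a - b : A) + b} : Set A) from (sub_add_cancel a b).symm)
    rw [h1, Hyperring.zero_hadd] at h2
    exact h2
  -- The descended map is `ψ` applied to chosen preimages; `hψ` makes the choice irrelevant.
  choose r hr using hq
  have hψ : ∀ a : A, HyperringCat.Hom.hom ψ (r (q.hom a)) = HyperringCat.Hom.hom ψ a := fun a =>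
    key _ _ (hr _)
  refine ⟨⟨
    { toFun := fun b : B => HyperringCat.Hom.hom ψ (r b)
      map_zero' := ?_
      map_one' := ?_
      map_mul' := ?_
      map_hadd' := ?_ }⟩, ?_⟩
  · have := hψ 0
    rw [map_zero] at this
    exact this.trans (map_zero (HyperringCat.Hom.hom ψ))
  · have := hψ 1
    rw [map_one] at this
    exact this.trans (map_one (HyperringCat.Hom.hom ψ))
  · intro (a : B) (b : B)
    have := hψ (r a * r b)
    rw [map_mul, hr, hr] at this
    exact this.trans (map_mul (HyperringCat.Hom.hom ψ) _ _)
  · rintro (a : B) (b : B) _ rfl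
    have := hψ (r a + r b)
    rw [map_add, hr, hr] at this
    exact Set.mem_of_eq_of_mem this ((HyperringCat.Hom.hom ψ).map_hadd rfl)
  · apply ConcreteCategory.hom_ext
    intro (a : A)
    exact hψ a

/-- A morphism from the spectrum of a hyperfield to a scheme is given by its image and a homomorphism
from the residue field. -/
theorem exists_residueField_hom {H : Type u} [Hyperring H] [IsHyperfield H] {Y : Scheme.{u}}
    (p : hyperfieldSpec H ⟶ schemeToLHS.obj Y) :
    ∃ (y : Y) (ψ : ringToHyperring.obj (Y.residueField y) ⟶ HyperringCat.of H),
      residuePoint y ψ = p := by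
  obtain ⟨y, hy⟩ : ∃ y : Y, p.toPsh.base (hyperfieldSpecPt H) = y := ⟨_, rfl⟩
  subst hy
  have hloc : IsLocalRing (Y.presheaf.stalk (p.toPsh.base (hyperfieldSpecPt H))) :=
    Y.toLocallyRingedSpace.isLocalRing (p.toPsh.base (hyperfieldSpecPt H))
  -- Locality is used here: the stalk homomorphism kills the maximal ideal, so it descends to the
  -- residue field.
  obtain ⟨ψ, hψ⟩ := exists_desc_of_surjective (Y.residue (p.toPsh.base (hyperfieldSpecPt H)))
    (Y.residue_surjective _) (stalkEval p.toPsh (hyperfieldSpecPt H)) fun a ha =>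
      ((isLocal_iff_stalkEval p.toPsh _).1 (p.isLocal _) a).2
        ((IsLocalRing.mem_maximalIdeal a).1 ((IsLocalRing.residue_eq_zero_iff a).1 ha))
  refine ⟨_, ψ, hyperfieldSpec_hom_ext rfl fun U hU _ s => ?_⟩
  have h1 := germ_stalkEval p.toPsh (hyperfieldSpecPt H) U hU
  rw [← hψ] at h1
  exact congrArg (fun g => HyperringCat.Hom.hom g s) h1

/-- The absolute value given by a homomorphism from a field to the tropical hyperfield. -/
noncomputable def abvOfHom {K : CommRingCat.{u}} (hK : IsField K)
    (ψ : ringToHyperring.obj K ⟶ HyperringCat.of Trop.{u}) : AbsoluteValue K ℝ where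
  toFun a := Trop.exp (HyperringCat.Hom.hom ψ a)
  map_mul' a b := (congrArg Trop.exp (map_mul (HyperringCat.Hom.hom ψ) a b)).trans
    (Trop.exp_mul _ _)
  nonneg' _ := Trop.exp_nonneg _
  eq_zero' a := Trop.exp_eq_zero.trans (hom_eq_zero_iff hK ψ a)
  add_le' a b := (Trop.exp_le_max_of_mem_hadd ((HyperringCat.Hom.hom ψ).map_hadd
    (show (a + b : K) ∈ ({a + b} : Set K) from rfl))).trans
      (max_le_add_of_nonneg (Trop.exp_nonneg _) (Trop.exp_nonneg _))

theorem log_abvOfHom {K : CommRingCat.{u}} (hK : IsField K)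
    (ψ : ringToHyperring.obj K ⟶ HyperringCat.of Trop.{u}) (a : K) :
    Trop.log (abvOfHom hK ψ a) = HyperringCat.Hom.hom ψ a :=
  Trop.log_exp _

/-! ### The comparison map on points -/

section Comparison

variable {k : Type u} [NormedField k]

theorem SpecSectionToField_top {k : Type u} [Field k] (y : Spec (CommRingCat.of k))
    (hy : y ∈ (⊤ : (Spec (CommRingCat.of k)).Opens)) :
    SpecSectionToField ⊤ y hy = (Scheme.ΓSpecIso (CommRingCat.of k)).hom := by
  unfold SpecSectionToField
  refine (congrArg (· ≫ (Scheme.ΓSpecIso (CommRingCat.of k)).hom)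
    ((Spec (CommRingCat.of k)).presheaf.map_id _)).trans ?_
  exact Category.id_comp _

/-- `Spec k` has one point, so an open set containing `X.hom x` is everything and the claim reduces
to global sections. -/
theorem evaluation_app_eq_toResidueField (X : Over (Spec (CommRingCat.of k))) (x : X.left)
    (U : (Spec (CommRingCat.of k)).Opens) (hU : X.hom x ∈ U) (s : Γ(Spec (CommRingCat.of k), U)) :
    (X.left.evaluation (X.hom ⁻¹ᵁ U) x hU).hom ((X.hom.app U).hom s) =
      (toResidueField X x).hom ((SpecSectionToField U _ hU).hom s) := by
  obtain rfl : U = ⊤ := top_le_iff.1 (Spec_eq_top U _ hU)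
  have h1 := SpecSectionToField_top (k := k) _ hU
  have h2 : X.hom.app ⊤ ≫ X.left.evaluation (X.hom ⁻¹ᵁ ⊤) x hU =
      SpecSectionToField ⊤ _ hU ≫ toResidueField X x := by
    rw [h1]
    exact (Iso.hom_inv_id_assoc _ _).symm
  exact congrArg (fun g => g.hom s) h2

variable [IsUltrametricDist k]

theorem Analytification.isNonarchimedean {X : Over (Spec (CommRingCat.of k))}
    (x : Analytification X) : IsNonarchimedean x.abv :=
  isNonarchimedean_of_extends x.abv (toResidueField X x.pt).hom x.abv_toResidueField

/-- Since `Spec k` has one point, two morphisms to it are compared by their values on sections, and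
those sections are elements of `k`. Thus being a morphism over `k` becomes the condition that the
absolute value extends the one on `k`. -/
theorem residuePoint_comp_eq_structureMap_iff {X : Over (Spec (CommRingCat.of k))} (x : X.left)
    (ψ : ringToHyperring.obj (X.left.residueField x) ⟶ HyperringCat.of Trop.{u}) :
    residuePoint x ψ ≫ schemeToLHS.map X.hom = structureMap (valuationHom k) ↔
      ∀ c : k, HyperringCat.Hom.hom ψ ((toResidueField X x).hom c) = Trop.log ‖c‖ := by
  constructor
  · intro h c
    -- Evaluation involves a membership proof depending on the morphism, so the equality is used by
    -- substitution for general `f` and `g`.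
    have h1 : ∀ f g : hyperfieldSpec Trop.{u} ⟶ schemeToLHS.obj (Spec (CommRingCat.of k)),
        f = g → ∀ s : Γ(Spec (CommRingCat.of k), ⊤),
        HyperringCat.Hom.hom (f.toPsh.c.app (op ⊤) ≫ hyperSpecEval (hyperfieldSpecPt Trop.{u})
          ((Opens.map f.toPsh.base).obj ⊤) trivial) s =
        HyperringCat.Hom.hom (g.toPsh.c.app (op ⊤) ≫ hyperSpecEval (hyperfieldSpecPt Trop.{u})
          ((Opens.map g.toPsh.base).obj ⊤) trivial) s := by
      rintro f _ rfl s
      rfl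
    have h2 := h1 _ _ h ((Scheme.ΓSpecIso (CommRingCat.of k)).inv.hom c)
    refine h2.trans (congrArg (fun a : k => Trop.log ‖a‖) ?_)
    have h3 := SpecSectionToField_top (k := k) (default : PrimeSpectrum k) trivial
    refine (congrArg (fun g => g.hom ((Scheme.ΓSpecIso (CommRingCat.of k)).inv.hom c)) h3).trans ?_
    exact congrArg (fun g => g.hom c) (Scheme.ΓSpecIso (CommRingCat.of k)).inv_hom_id
  · intro h
    refine hyperfieldSpec_hom_ext (Subsingleton.elim (α := PrimeSpectrum k) _ _)
      fun U hf hg s => ?_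
    refine (congrArg (HyperringCat.Hom.hom ψ)
      (evaluation_app_eq_toResidueField X x U hf s)).trans ?_
    exact h _

/-- The `𝕋`-point given by a point of the analytification. -/
noncomputable def tropPoint {X : Over (Spec (CommRingCat.of k))} (x : Analytification X) :
    HPoints (valuationHom k) X :=
  ⟨residuePoint x.pt (logAbv x.abv x.isNonarchimedean),
    (residuePoint_comp_eq_structureMap_iff _ _).2 fun c =>
      congrArg Trop.log (x.abv_toResidueField c)⟩

theorem pt_tropPoint {X : Over (Spec (CommRingCat.of k))} (x : Analytification X) :
    (tropPoint x).pt = x.pt :=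
  rfl

theorem value_tropPoint {X : Over (Spec (CommRingCat.of k))} (x : Analytification X)
    (U : X.left.Opens) (hU : x.pt ∈ U) (hU' : (tropPoint x).pt ∈ U) (s : Γ(X.left, U)) :
    (tropPoint x).value U hU' s = Trop.log (x.value U hU s) :=
  rfl

theorem HPoints.ext' {X : Over (Spec (CommRingCat.of k))} {p q : HPoints (valuationHom k) X}
    (h : p.pt = q.pt) (h' : ∀ (U : X.left.Opens) (hp : p.pt ∈ U) (hq : q.pt ∈ U)
      (s : Γ(X.left, U)), p.value U hp s = q.value U hq s) : p = q :=
  Subtype.ext (hyperfieldSpec_hom_ext h h')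

theorem HPoints.pt_map {X Y : Over (Spec (CommRingCat.of k))} (f : X ⟶ Y)
    (p : HPoints (valuationHom k) X) : (HPoints.map f p).pt = f.left p.pt :=
  rfl

theorem HPoints.value_map {X Y : Over (Spec (CommRingCat.of k))} (f : X ⟶ Y)
    (p : HPoints (valuationHom k) X) (U : Y.left.Opens) (hU : (HPoints.map f p).pt ∈ U)
    (hU' : p.pt ∈ f.left ⁻¹ᵁ U) (s : Γ(Y.left, U)) :
    (HPoints.map f p).value U hU s = p.value (f.left ⁻¹ᵁ U) hU' (f.left.app U s) :=
  rfl

theorem tropPoint_map {X Y : Over (Spec (CommRingCat.of k))} (f : X ⟶ Y) (x : Analytification X) :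
    tropPoint (Analytification.map f x) = HPoints.map f (tropPoint x) := by
  have hpt : (HPoints.map f (tropPoint x)).pt = (Analytification.map f x).pt :=
    (HPoints.pt_map f (tropPoint x)).trans (congrArg f.left (pt_tropPoint x))
  refine HPoints.ext' ((pt_tropPoint _).trans hpt.symm) fun U hU hU' s => ?_
  have h1 : (Analytification.map f x).pt ∈ U := hpt ▸ hU'
  have h2 : (tropPoint x).pt ∈ f.left ⁻¹ᵁ U := h1
  refine (value_tropPoint _ U h1 hU s).trans ?_
  refine Eq.trans ?_ (HPoints.value_map f (tropPoint x) U hU' h2 s).symm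
  refine Eq.trans ?_ (value_tropPoint x (f.left ⁻¹ᵁ U) h1 h2 _).symm
  exact congrArg Trop.log (Analytification.value_map f x U h1 s)

/-- Each element of `κ(x)` is the value at `x` of a section on some neighbourhood, so the absolute
value is recovered from the values of the `𝕋`-point. -/
theorem injective_tropPoint (X : Over (Spec (CommRingCat.of k))) :
    Function.Injective (tropPoint (X := X)) := by
  rintro ⟨x, v, hv⟩ ⟨y, w, hw⟩ h
  obtain rfl : x = y := congrArg HPoints.pt h
  have hvw : v = w := by
    ext a
    obtain ⟨a, rfl⟩ := X.left.residue_surjective x a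
    obtain ⟨U, hU, s, rfl⟩ := X.left.presheaf.exists_germ_eq a
    have h1 : ∀ (p q : HPoints (valuationHom k) X) (hpq : p = q) (hp : p.pt ∈ U),
        p.value U hp s = q.value U (hpq ▸ hp) s := by
      rintro p _ rfl hp
      rfl
    exact Trop.log_inj (v.nonneg _) (w.nonneg _) (h1 _ _ h hU)
  subst hvw
  rfl

theorem HPoints.value_residuePoint {X : Over (Spec (CommRingCat.of k))} (x : X.left)
    (ψ : ringToHyperring.obj (X.left.residueField x) ⟶ HyperringCat.of Trop.{u})
    (hψ : residuePoint x ψ ≫ schemeToLHS.map X.hom = structureMap (valuationHom k))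
    (U : X.left.Opens) (hU : x ∈ U)
    (hU' : HPoints.pt (⟨residuePoint x ψ, hψ⟩ : HPoints (valuationHom k) X) ∈ U)
    (s : Γ(X.left, U)) :
    HPoints.value (⟨residuePoint x ψ, hψ⟩ : HPoints (valuationHom k) X) U hU' s =
      HyperringCat.Hom.hom ψ ((X.left.evaluation U x hU).hom s) :=
  rfl

theorem surjective_tropPoint (X : Over (Spec (CommRingCat.of k))) :
    Function.Surjective (tropPoint (X := X)) := by
  rintro ⟨p, hp⟩
  obtain ⟨x, ψ, rfl⟩ := exists_residueField_hom p
  have hψ := (residuePoint_comp_eq_structureMap_iff x ψ).1 hp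
  -- Exponentiating `ψ` gives the absolute value; the condition over `k` for `ψ` says that it
  -- extends the norm.
  let y : Analytification X := ⟨x, abvOfHom (Field.toIsField (X.left.residueField x)) ψ,
    fun c => (congrArg Trop.exp (hψ c)).trans ((Trop.exp_log _).trans (abs_norm c))⟩
  refine ⟨y, HPoints.ext' (pt_tropPoint y) fun U hU hU' s => ?_⟩
  refine (value_tropPoint y U hU' hU s).trans ?_
  refine Eq.trans ?_ (HPoints.value_residuePoint x ψ hp U hU' hU' s).symm
  exact log_abvOfHom (Field.toIsField (X.left.residueField x)) ψ _

/-- The bijection between the points of the analytification and the `𝕋`-points. -/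
noncomputable def tropEquiv (X : Over (Spec (CommRingCat.of k))) :
    Analytification X ≃ HPoints (valuationHom k) X :=
  Equiv.ofBijective tropPoint ⟨injective_tropPoint X, surjective_tropPoint X⟩

end Comparison

/-! ### The topology of the analytification -/

namespace Analytification

section

variable {k : Type u} [NormedField k] {X Y : Over (Spec (CommRingCat.of k))}

theorem isOpen_setOf_value_mem (U : X.left.Opens) (s : Γ(X.left, U)) {V : Set ℝ} (hV : IsOpen V) :
    IsOpen {x : Analytification X | ∃ hU : x.pt ∈ U, x.value U hU s ∈ V} :=
  TopologicalSpace.isOpen_generateFrom_of_mem ⟨U, s, V, hV, rfl⟩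

/-- For the zero section and the target set `ℝ` the condition on values is vacuous, so the
generating sets include the preimages of Zariski open sets. -/
theorem isOpen_setOf_pt_mem (U : X.left.Opens) : IsOpen {x : Analytification X | x.pt ∈ U} := by
  simpa using isOpen_setOf_value_mem U 0 isOpen_univ

theorem continuous_value (U : X.left.Opens) (s : Γ(X.left, U)) :
    Continuous fun x : {x : Analytification X | x.pt ∈ U} => x.1.value U x.2 s := by
  refine continuous_def.2 fun V hV => ?_
  convert (isOpen_setOf_value_mem U s hV).preimage continuous_subtype_val using 1
  ext x
  exact ⟨fun h => ⟨x.2, h⟩, fun ⟨_, h⟩ => h⟩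

theorem value_res (x : Analytification X) {U V : X.left.Opens} (i : V ⟶ U) (hV : x.pt ∈ V)
    (s : Γ(X.left, U)) :
    x.value V hV (X.left.presheaf.map i.op s) = x.value U (i.le hV) s :=
  congrArg (fun a => x.abv ((X.left.residue x.pt).hom a))
    (X.left.presheaf.germ_res_apply i x.pt hV s)

theorem value_mul (x : Analytification X) (U : X.left.Opens) (hU : x.pt ∈ U)
    (s t : Γ(X.left, U)) : x.value U hU (s * t) = x.value U hU s * x.value U hU t := by
  simp only [value, map_mul]

theorem value_pow (x : Analytification X) (U : X.left.Opens) (hU : x.pt ∈ U)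
    (s : Γ(X.left, U)) (n : ℕ) : x.value U hU (s ^ n) = x.value U hU s ^ n := by
  simp only [value, map_pow]

theorem value_ne_zero_iff (x : Analytification X) (U : X.left.Opens) (hU : x.pt ∈ U)
    (s : Γ(X.left, U)) : x.value U hU s ≠ 0 ↔ x.pt ∈ X.left.basicOpen s :=
  (AbsoluteValue.ne_zero_iff _).trans (X.left.evaluation_ne_zero_iff_mem_basicOpen x.pt hU s)

/-- On an affine scheme the topology of the analytification is determined by the absolute values of
global sections. -/
theorem continuous_of_isAffine [IsAffine X.left] {Z : Type*} [TopologicalSpace Z]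
    {g : Z → Analytification X}
    (hg : ∀ a : Γ(X.left, ⊤), Continuous fun z => (g z).value ⊤ trivial a) : Continuous g := by
  refine continuous_generateFrom_iff.2 ?_
  rintro _ ⟨U, s, V, hV, rfl⟩
  refine isOpen_iff_forall_mem_open.2 ?_
  rintro z ⟨hU, hs⟩
  -- Shrinking to a basic open set `D(f) ⊆ U` around the point makes the section a fraction of
  -- global sections: `s * f ^ n = a` on `D(f)`.
  obtain ⟨f, hfU, hf⟩ := (isAffineOpen_top X.left).exists_basicOpen_le ⟨_, hU⟩ trivial
  have hloc := (isAffineOpen_top X.left).isLocalization_basicOpen f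
  obtain ⟨n, a, ha⟩ := IsLocalization.Away.surj f (X.left.presheaf.map (homOfLE hfU).op s)
  have key : ∀ (x : Analytification X) (hx : x.pt ∈ X.left.basicOpen f),
      x.value U (hfU hx) s = x.value ⊤ trivial a / x.value ⊤ trivial f ^ n := by
    intro x hx
    rw [eq_div_iff (pow_ne_zero n ((x.value_ne_zero_iff ⊤ trivial f).2 hx))]
    have h := congrArg (x.value _ hx) ha
    rw [value_mul, value_pow, value_res] at h
    have hres (b : Γ(X.left, ⊤)) :=
      x.value_res (homOfLE (X.left.basicOpen_le f)) hx b
    exact (congrArg (fun r => x.value U (hfU hx) s * r ^ n) (hres f).symm).trans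
      (h.trans (hres a))
  have hopen : IsOpen {z | (g z).value ⊤ trivial f ≠ 0} := isOpen_ne_fun (hg f) continuous_const
  have hcont : ContinuousOn
      (fun z => (g z).value ⊤ trivial a / (g z).value ⊤ trivial f ^ n)
      {z | (g z).value ⊤ trivial f ≠ 0} :=
    (hg a).continuousOn.div ((hg f).pow n).continuousOn fun z hz => pow_ne_zero n hz
  -- The neighbourhood of `z` is the set where `|f| ≠ 0` and `|a| / |f| ^ n ∈ V`.
  refine ⟨_, ?_, hcont.isOpen_inter_preimage hopen hV, ?_⟩
  · rintro z' ⟨h1, h2⟩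
    have hz' := ((g z').value_ne_zero_iff ⊤ trivial f).1 h1
    refine ⟨hfU hz', ?_⟩
    rw [key _ hz']
    exact h2
  · refine ⟨((g z).value_ne_zero_iff ⊤ trivial f).2 hf, ?_⟩
    rw [Set.mem_preimage, ← key _ hf]
    exact hs

/-- A point of the analytification lying over an open subscheme comes from its analytification. -/
theorem exists_map_eq (j : X ⟶ Y) [IsOpenImmersion j.left] (y : Analytification Y)
    (hy : y.pt ∈ j.left ''ᵁ ⊤) : ∃ x : Analytification X, map j x = y := by
  obtain ⟨y, v, hv⟩ := y
  obtain ⟨x, -, hx⟩ := hy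
  dsimp only at hx
  subst hx
  -- An open immersion induces an isomorphism of residue fields, so `v` is transported along its
  -- inverse.
  have hinv (b) : (inv (j.left.residueFieldMap x)).hom ((j.left.residueFieldMap x).hom b) = b :=
    congrArg (fun g => g.hom b) (IsIso.hom_inv_id (j.left.residueFieldMap x))
  let w : AbsoluteValue (X.left.residueField x) ℝ :=
    v.comp (f := (inv (j.left.residueFieldMap x)).hom) (RingHom.injective _)
  have hw (b) : w ((j.left.residueFieldMap x).hom b) = v b := congrArg v (hinv b)
  refine ⟨⟨x, w, fun c => ?_⟩, ext' rfl fun a => ?_⟩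
  · refine Eq.trans (congrArg w ?_) ((hw _).trans (hv c))
    have h : toResidueField Y (j.left x) ≫ j.left.residueFieldMap x = toResidueField X x := by
      have hj : X.hom.appTop = Y.hom.appTop ≫ j.left.appTop := by
        rw [← Scheme.Hom.comp_appTop, Over.w]
      unfold toResidueField
      rw [Category.assoc, Category.assoc, Scheme.Γevaluation_naturality, hj, Category.assoc]
    exact congrArg (fun g => g.hom c) h.symm
  · exact hw a

/-- This rewrites a function on `X^an` as a function on the part of `Y^an` over the image of `j`,
where continuity holds by definition of the topology of `Y^an`. -/
theorem value_map_image (j : X ⟶ Y) [IsOpenImmersion j.left] (x : Analytification X)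
    (U : X.left.Opens) (hU : x.pt ∈ U) (hU' : (map j x).pt ∈ j.left ''ᵁ U) (s : Γ(X.left, U)) :
    (map j x).value (j.left ''ᵁ U) hU' ((j.left.appIso U).inv s) = x.value U hU s := by
  have h := congrArg (fun g => g.hom s) (j.left.appIso_inv_app U)
  refine (value_map j x _ hU' _).trans ?_
  refine (congrArg (x.value _ hU') h).trans ?_
  exact x.value_res (eqToHom (j.left.preimage_image_eq U)) hU' s

end

end Analytification

/-! ### The comparison homeomorphism -/

section Homeomorph

variable {k : Type u} [NormedField k] [IsUltrametricDist k]

/-- Over the image of `j`, the map factors through `X(𝕋)` with its affine topology, from which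
`HPoints.map j` is continuous by definition of the fine topology. The lift `g` to `X^an` is merely
chosen: its continuity is never required, since maps into the affine topology are tested on global
sections, whose values are read on `Y^an`. -/
theorem continuousOn_tropPoint {X Y : Over (Spec (CommRingCat.of k))} [hX : IsAffine X.left]
    (j : X ⟶ Y) [IsOpenImmersion j.left] :
    ContinuousOn (tropPoint (X := Y)) {y | y.pt ∈ j.left ''ᵁ ⊤} := by
  rw [continuousOn_iff_continuous_domRestrict]
  choose g hg using fun y : {y : Analytification Y | y.pt ∈ j.left ''ᵁ ⊤} =>
    Analytification.exists_map_eq j y.1 y.2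
  have h : Set.domRestrict {y : Analytification Y | y.pt ∈ j.left ''ᵁ ⊤} tropPoint =
      HPoints.map j ∘ fun y => tropPoint (g y) := by
    funext y
    rw [Set.domRestrict_apply, Function.comp_apply, ← tropPoint_map, hg]
  rw [h]
  have h1 : @Continuous _ _ (HPoints.affineTopology X) _
      (HPoints.map j : HPoints (valuationHom k) X → HPoints (valuationHom k) Y) :=
    continuous_iff_coinduced_le.2 (le_iSup_of_le X (le_iSup_of_le hX (le_iSup_of_le j le_rfl)))
  refine @Continuous.comp _ _ _ _ (HPoints.affineTopology X) _ _ _ h1 ?_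
  refine continuous_iInf_rng.2 fun a => continuous_induced_rng.2 ?_
  have h2 : ((fun p : HPoints (valuationHom k) X => p.value ⊤ trivial a) ∘
      fun y => tropPoint (g y)) = fun y => Trop.log (y.1.value (j.left ''ᵁ ⊤) y.2
        ((j.left.appIso ⊤).inv a)) := by
    funext y
    refine (value_tropPoint (g y) ⊤ trivial trivial a).trans (congrArg Trop.log ?_)
    have h3 : ∀ z (hz : Analytification.map j (g y) = z) (hz' : z.pt ∈ j.left ''ᵁ ⊤),
        (g y).value ⊤ trivial a = z.value _ hz' ((j.left.appIso ⊤).inv a) := by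
      rintro _ rfl hz'
      exact (Analytification.value_map_image j (g y) ⊤ trivial hz' a).symm
    exact h3 _ (hg y) y.2
  rw [h2]
  exact Trop.continuous_log.comp (Analytification.continuous_value _ _)

/-- Continuity is local, and the preimages of affine open subschemes are open in `X^an` and cover
it. -/
theorem continuous_tropPoint (X : Over (Spec (CommRingCat.of k))) :
    Continuous (tropPoint (X := X)) := by
  refine continuous_iff_continuousAt.2 fun x => ?_
  obtain ⟨U, hU, hxU, -⟩ := exists_isAffineOpen_mem_and_subset (U := ⊤) (x := x.pt) trivial
  let j : Over.mk (U.ι ≫ X.hom) ⟶ X := Over.homMk U.ι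
  have : IsAffine (Over.mk (U.ι ≫ X.hom)).left := hU
  have : IsOpenImmersion j.left := inferInstanceAs (IsOpenImmersion U.ι)
  refine (continuousOn_tropPoint j).continuousAt
    ((Analytification.isOpen_setOf_pt_mem _).mem_nhds ?_)
  exact ⟨⟨x.pt, hxU⟩, trivial, rfl⟩

theorem tropPoint_tropEquiv_symm {X : Over (Spec (CommRingCat.of k))}
    (p : HPoints (valuationHom k) X) : tropPoint ((tropEquiv X).symm p) = p :=
  (tropEquiv X).apply_symm_apply p

theorem tropEquiv_symm_map {X Y : Over (Spec (CommRingCat.of k))} (f : X ⟶ Y)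
    (p : HPoints (valuationHom k) X) :
    (tropEquiv Y).symm (HPoints.map f p) = Analytification.map f ((tropEquiv X).symm p) := by
  apply injective_tropPoint
  rw [tropPoint_map, tropPoint_tropEquiv_symm, tropPoint_tropEquiv_symm]

/-- The inverse exponentiates the values of global sections, so it is continuous for the affine
topology once the Berkovich topology is tested on global sections. -/
theorem value_tropEquiv_symm {X : Over (Spec (CommRingCat.of k))}
    (p : HPoints (valuationHom k) X) (a : Γ(X.left, ⊤)) :
    ((tropEquiv X).symm p).value ⊤ trivial a = Trop.exp (p.value ⊤ trivial a) := by
  obtain ⟨x, rfl⟩ := surjective_tropPoint X p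
  rw [show (tropEquiv X).symm (tropPoint x) = x from (tropEquiv X).symm_apply_apply x]
  refine Eq.trans ?_ (congrArg Trop.exp (value_tropPoint x ⊤ trivial trivial a)).symm
  rw [Trop.exp_log]
  exact (abs_of_nonneg (x.abv.nonneg _)).symm

/-- The fine topology is final for the maps `Y(𝕋) → X(𝕋)` with `Y` affine. By naturality each
composite with the inverse passes through `Y^an`, leaving only continuity of `Y(𝕋) → Y^an` for the
affine topology. -/
theorem continuous_tropEquiv_symm (X : Over (Spec (CommRingCat.of k))) :
    Continuous (tropEquiv X).symm := by
  refine continuous_iSup_dom.2 fun Y => continuous_iSup_dom.2 fun hY =>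
    continuous_iSup_dom.2 fun f => continuous_coinduced_dom.2 ?_
  have h : (tropEquiv X).symm ∘ HPoints.map f = Analytification.map f ∘ (tropEquiv Y).symm :=
    funext fun p => tropEquiv_symm_map f p
  rw [h]
  let _ := HPoints.affineTopology (φ := valuationHom k) Y
  refine (Analytification.continuous_map f).comp (Analytification.continuous_of_isAffine fun a => ?_)
  have h1 : (fun p => ((tropEquiv Y).symm p).value ⊤ trivial a) =
      Trop.exp ∘ fun p : HPoints (valuationHom k) Y => p.value ⊤ trivial a :=
    funext fun p => value_tropEquiv_symm p a
  rw [h1]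
  refine Trop.continuous_exp.comp (continuous_iff_le_induced.2 (iInf_le _ a))

/-- The homeomorphism from the analytification to the set of `𝕋`-points with the fine Zariski
topology. -/
noncomputable def tropHomeomorph (X : Over (Spec (CommRingCat.of k))) :
    Analytification X ≃ₜ HPoints (valuationHom k) X where
  toEquiv := tropEquiv X
  continuous_toFun := continuous_tropPoint X
  continuous_invFun := continuous_tropEquiv_symm X

/-- The isomorphism between the analytification functor and the functor of `𝕋`-points. -/
noncomputable def tropFunctorIso (k : Type u) [NormedField k] [IsUltrametricDist k] :
    analytificationFunctor k ≅ pointsFunctor (valuationHom k) :=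
  NatIso.ofComponents (fun X => TopCat.isoOfHomeo (tropHomeomorph X.obj)) fun f => by
    ext x
    exact tropPoint_map f.hom x

end Homeomorph

end HyperGeom

theorem mainTheorem2 (k : Type u) [NormedField k] [IsUltrametricDist k] [CompleteSpace k] :
    ∃ h : ∀ X : HyperGeom.FiniteTypeSchemes k,
        HyperGeom.Analytification X.obj ≃ₜ HyperGeom.HPoints (HyperGeom.valuationHom k) X.obj,
      (∀ (X : HyperGeom.FiniteTypeSchemes k) (x : HyperGeom.Analytification X.obj),
        (h X x).pt = x.pt ∧
          ∀ (U : X.obj.left.Opens) (hU : x.pt ∈ U) (hU' : (h X x).pt ∈ U) (s : Γ(X.obj.left, U)),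
            (h X x).value U hU' s = HyperGeom.Trop.log (x.value U hU s)) ∧
      ∃ e : HyperGeom.analytificationFunctor k ≅
          HyperGeom.pointsFunctor (HyperGeom.valuationHom k),
        ∀ (X : HyperGeom.FiniteTypeSchemes k) (x : HyperGeom.Analytification X.obj),
          e.hom.app X x = h X x := by
  refine ⟨fun X => HyperGeom.tropHomeomorph X.obj,
    fun X x => ⟨HyperGeom.pt_tropPoint x, fun U hU hU' s =>
      HyperGeom.value_tropPoint x U hU hU' s⟩,
    HyperGeom.tropFunctorIso k, fun X x => rfl⟩
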